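/- **Models.** For $\gamma\in[0,1]$, $\mathcal G(n,\gamma)$ is the Erdős–Rényi graph on $[n]$ in which all pairs are connected independently with probability $\gamma$. $\mathcal G(n,k,\gamma)$ is the planted clique model: choose a set $C$ of $k$ vertices uniformly at random, independently of a graph drawn from $\mathcal G(n,\gamma)$, and add all edges inside $C$. $\mathcal G(N,K,p,q)$ is the planted dense subgraph model on $[N]$: each vertex joins a random set $S$ independently with probability $K/N$; given $S$, pairs of vertices are connected independently, with probability $p$ if both lie in $S$ and with probability $q$ otherwise. $d_{\rm TV}(\mu,\nu)=\frac12\int|d\mu-d\nu|$. **Reduction.** Let $\ell\ge 1$, $1\le k\le n$, $\gamma\in(0,\frac12]$, $q\in[0,1]$, $p=2q$, $N=\ell n$, $K=k\ell$, $m_0=\lfloor\log_2(1/\gamma)\rfloor$. For integers $a,b\ge0$ put $P_{ab}=\mathrm{Binom}(ab,p)$, $Q_{ab}=\mathrm{Binom}(ab,q)$, $$P'_{ab}(m)=\begin{cases}P_{ab}(0)+\sum_{m_0<j\le ab}\big[P_{ab}(j)-\tfrac1\gamma Q_{ab}(j)\big], & m=0,\\ P_{ab}(m), & 1\le m\le m_0,\\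 \tfrac1\gamma Q_{ab}(m), & m>m_0,\end{cases}\qquad Q'_{ab}=\frac{1}{1-\gamma}\big(Q_{ab}-\gamma P'_{ab}\big).$$ Given a graph $G$ on $[n]$ with adjacency matrix $A$, a random graph $\widetilde G$ on $[N]$ is generated as follows. Each vertex of $[N]$ gets, independently, a uniformly random parent in $[n]$; let $V_s$ be the set of vertices with parent $s$ and $\ell_s=|V_s|$. Given $G$ and the parents, independently for all $1\le s\le t\le n$, draw a number $E_{st}$ of edges: $E_{ss}\sim\mathrm{Binom}(\binom{\ell_s}{2},q)$, and for $s<t$, $E_{st}\sim P'_{\ell_s\ell_t}$ if $A_{st}=1$ and $\ell_s,\ell_t\le2\ell$; $E_{st}\sim Q'_{\ell_s\ell_t}$ if $A_{st}=0$ and $\ell_s,\ell_t\le 2\ell$; $E_{st}\sim Q_{\ell_s\ell_t}$ if $\max\{\ell_s,\ell_t\}>2\ell$. Then choose uniformly at random a set of $E_{st}$ edges among the possible edges between $V_s$ and $V_t$ (inside $V_s$ if $s=t$). The edges of $\widetilde G$ are all the edges so chosen. **Proposition.** Assume that $16q\ell^2\le1$ and $k\ge6e\ell$. Then the following hold. 1.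 $P'_{ab}$ and $Q'_{ab}$ are probability distributions whenever $a,b\le2\ell$, so the reduction is well defined. 2. If $G\sim\mathcal G(n,\gamma)$, then $\widetilde G\sim\mathcal G(N,q)$. 3. If $G\sim\mathcal G(n,k,\gamma)$ and $\widetilde{\mathbb P}$ is the law of $\widetilde G$, then $$d_{\rm TV}\big(\widetilde{\mathbb P},\,\mathcal G(N,K,2q,q)\big)\le e^{-K/12}+1.5\,k\,e^{-\ell/18}+2k^2(8q\ell^2)^{m_0+1}+0.5\sqrt{e^{72e^2q\ell^2}-1}+\sqrt{0.5\,k}\;e^{-\ell/36}.$$ -/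

import Mathlib

open MeasureTheory ProbabilityTheory unitInterval

namespace PlantedReduction

noncomputable section

/-- The total variation distance `(1/2) ∫ |dμ - dν|` of two finite measures on a finite space. -/
def tvDist {Ω : Type*} [Fintype Ω] [MeasurableSpace Ω] (μ ν : Measure Ω) : ℝ :=
  (1 / 2) * ∑ x : Ω, |μ.real {x} - ν.real {x}|

/-- The unordered pairs both of whose members lie in `S`. -/
def pairsIn {V : Type*} (S : Set V) : Set (Sym2 V) := {e | ∀ v ∈ e, v ∈ S}

/-- The planted clique model `G(n, k, γ)`: a uniformly random set `C` of `k` vertices is turned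
into a clique of an independent Erdős–Rényi graph `G(n, γ)`. -/
def plantedClique (n k : ℕ) (γ : I) : Measure (SimpleGraph (Fin n)) :=
  (uniformOn {C : Set (Fin n) | C.ncard = k}).bind fun C =>
    (SimpleGraph.binomialRandom (Fin n) γ).map fun G => G ⊔ SimpleGraph.fromEdgeSet (pairsIn C)

/-- The planted dense subgraph model `G(N, K, p, q)`: every vertex joins the random set `S`
independently with probability `K / N` (for `K ≤ N`, `projIcc` does not change this number);
given `S`, all pairs of distinct vertices are connected independently, with probability `p` for
pairs inside `S` and with probability `q` for all other pairs. -/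
def plantedDense (N K : ℕ) (p q : I) : Measure (SimpleGraph (Fin N)) :=
  (setBernoulli (Set.univ : Set (Fin N)) (Set.projIcc (0 : ℝ) 1 zero_le_one (K / N))).bind
    fun S => ((setBernoulli (pairsIn S) p).prod (setBernoulli (pairsIn S)ᶜ q)).map
      fun x => SimpleGraph.fromEdgeSet (x.1 ∪ x.2)

/-- The number `m₀ = ⌊log₂ (1 / γ)⌋`. -/
def mZero (γ : I) : ℕ := ⌊Real.logb 2 (1 / (γ : ℝ))⌋₊

/-- The probability of `m` under the binomial distribution `Binom(M, p)`. -/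
def binomMass (M : ℕ) (p : I) (m : ℕ) : ℝ := (binomial M p).real {m}

/-- The mass function `P'_{ab}`, obtained from `P_{ab} = Binom(ab, p)` by replacing its masses above
`m₀` by those of `Q_{ab} / γ`, where `Q_{ab} = Binom(ab, q)`, and by correcting the mass at `0`. -/
def massP (γ p q : I) (a b m : ℕ) : ℝ :=
  if m = 0 then
    binomMass (a * b) p 0 +
      ∑ j ∈ Finset.Ioc (mZero γ) (a * b),
        (binomMass (a * b) p j - 1 / (γ : ℝ) * binomMass (a * b) q j)
  else if m ≤ mZero γ then binomMass (a * b) p m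
  else 1 / (γ : ℝ) * binomMass (a * b) q m

/-- The mass function `Q'_{ab} = (Q_{ab} - γ P'_{ab}) / (1 - γ)`. -/
def massQ (γ p q : I) (a b m : ℕ) : ℝ :=
  1 / (1 - (γ : ℝ)) * (binomMass (a * b) q m - (γ : ℝ) * massP γ p q a b m)

/-- The real function `w` is the mass function of a probability distribution on `ℕ`. -/
def IsMassFunction (w : ℕ → ℝ) : Prop := (∀ m, 0 ≤ w m) ∧ HasSum w 1

/-- The measure on `ℕ` with masses `w m`. -/
def ofMass (w : ℕ → ℝ) : Measure ℕ :=
  Measure.sum fun m => ENNReal.ofReal (w m) • Measure.dirac m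

/-- The number of children of `s` when `f` assigns to every vertex its parent. -/
def numChildren {n N : ℕ} (f : Fin N → Fin n) (s : Fin n) : ℕ := (f ⁻¹' {s}).ncard

open Classical in
/-- The conditional law of the number of edges between the children of `s` and the children of `t`
(inside the set of children of `s`, if `s = t`), given the parent map `f` and the graph `G`. -/
def edgeCountLaw (ℓ : ℕ) (γ p q : I) {n N : ℕ} (G : SimpleGraph (Fin n)) (f : Fin N → Fin n)
    (s t : Fin n) : Measure ℕ :=
  if s = t then binomial ((numChildren f s).choose 2) q
  else if 2 * ℓ < max (numChildren f s) (numChildren f t) then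
    binomial (numChildren f s * numChildren f t) q
  else if G.Adj s t then ofMass (massP γ p q (numChildren f s) (numChildren f t))
  else ofMass (massQ γ p q (numChildren f s) (numChildren f t))

/-- The potential edges between the children of `s` and the children of `t`: the unordered pairs of
distinct vertices, one with parent `s` and the other with parent `t`. -/
def block {n N : ℕ} (f : Fin N → Fin n) (s t : Fin n) : Set (Sym2 (Fin N)) :=
  {e | ∃ i j, i ≠ j ∧ f i = s ∧ f j = t ∧ e = s(i, j)}

/-- The conditional law of the set of edges between the children of `s` and the children of `t`:
draw the number of edges, then a uniformly random set of that many potential edges. -/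
def blockLaw (ℓ : ℕ) (γ p q : I) {n N : ℕ} (G : SimpleGraph (Fin n)) (f : Fin N → Fin n)
    (s t : Fin n) : Measure (Set (Sym2 (Fin N))) :=
  (edgeCountLaw ℓ γ p q G f s t).bind fun m => uniformOn {F | F ⊆ block f s t ∧ F.ncard = m}

/-- The randomized reduction: the law of the output graph on `N` vertices for the input graph `G`.
Every vertex independently gets a uniformly random parent; given the parents, the edge sets of the
blocks with `s ≤ t` are drawn independently and put together. -/
def reduction (ℓ : ℕ) (γ p q : I) {n : ℕ} (N : ℕ) (G : SimpleGraph (Fin n)) :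
    Measure (SimpleGraph (Fin N)) :=
  (Measure.pi fun _ : Fin N => uniformOn (Set.univ : Set (Fin n))).bind fun f =>
    (Measure.pi fun st : {st : Fin n × Fin n // st.1 ≤ st.2} =>
      blockLaw ℓ γ p q G f st.1.1 st.1.2).map fun F => SimpleGraph.fromEdgeSet (⋃ st, F st)

end

end PlantedReduction

namespace PlantedReduction

/-! Fix the parent map `f`. Exactly one input pair governs each off-diagonal block, so averaging
over an Erdős–Rényi input keeps the blocks independent and replaces each count law by its average
(`sum_edgeLaw_mul_prod`). As γP' + (1-γ)Q' = Q, every count becomes binomial with parameter q, and a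
binomial count followed by a uniform subset is a set of independent edges (`blockMass_binomMass`).
This gives the Erdős–Rényi output. The cut at m₀ makes Q' nonnegative: up to m₀ the ratio P/Q is at
most 2^m ≤ 1/γ, and beyond m₀ the mass of P' is set to Q/γ. The mass moved is geometrically small
because 1/γ < 2^(m₀+1).

With a clique on C, blocks between distinct parents in C carry P' instead, provided both parents
have at most 2ℓ children. The set S = f⁻¹(C) has exactly the law of the planted set
(`setBernoulli_real_eq_card_parentMaps`), so it suffices to compare the two models for each S with
|S| ≤ 1.5kℓ; larger S are rare by a Chernoff bound. Given S, three errors remain. (1) Parent maps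
giving some vertex of C more than 2ℓ children are discarded (`card_filter_not_fewChildren_le`). (2)
P' is replaced by Binom(ab, 2q) in at most k² blocks (`sum_abs_outputMass_sub_le`). (3) The
resulting comparison law still gives siblings inside S edge probability q instead of 2q. Averaging
over f hides this: in the second moment relative to the planted law, two maps f, f' contribute
(1+y)^c, where y = q/(2(1-2q)) and c counts the pairs in S that are siblings under both
(`sum_edgeLaw_mul_div_eq`). Resampling f' one vertex at a time bounds the average over f' by
(1+4yℓ/k)^|S| ≤ exp(6qℓ²) (`sum_pow_card_collisions_le`), and Cauchy–Schwarz turns this into an L¹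
bound (`sum_abs_mixture_sub_le`).

Conditioning on S is expressed by unnormalized sums over `parentMaps C S`, so that empty fibers need
no separate treatment. -/

/-! ### Binomial masses and the validity of P' and Q' -/

lemma binomMass_eq (M : ℕ) (p : I) (m : ℕ) :
    binomMass M p m = (M.choose m) * (p : ℝ) ^ m * (1 - p) ^ (M - m) :=
  binomial_real_singleton M m p

lemma binomMass_nonneg (M : ℕ) (p : I) (m : ℕ) : 0 ≤ binomMass M p m := measureReal_nonneg

lemma binomMass_eq_zero {M m : ℕ} (p : I) (h : M < m) : binomMass M p m = 0 := by
  simp [binomMass_eq, Nat.choose_eq_zero_of_lt h]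

lemma sum_binomMass (M : ℕ) (p : I) : ∑ m ∈ Finset.range (M + 1), binomMass M p m = 1 := by
  have h := add_pow (p : ℝ) (1 - p) M
  rw [add_sub_cancel, one_pow] at h
  rw [h]
  refine Finset.sum_congr rfl fun m _ => ?_
  rw [binomMass_eq]
  ring

lemma binomMass_le_pow (M : ℕ) (p : I) (m : ℕ) : binomMass M p m ≤ (M * (p : ℝ)) ^ m := by
  rw [binomMass_eq, mul_pow]
  have hp0 : (0 : ℝ) ≤ p := p.2.1
  have hp1 : (0 : ℝ) ≤ 1 - p := sub_nonneg.2 p.2.2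
  have h1 : (1 - (p : ℝ)) ^ (M - m) ≤ 1 := pow_le_one₀ hp1 (by linarith)
  have h2 : (M.choose m : ℝ) ≤ (M : ℝ) ^ m := by exact_mod_cast Nat.choose_le_pow M m
  calc _ ≤ (M : ℝ) ^ m * (p : ℝ) ^ m * 1 := by gcongr
    _ = _ := mul_one _

/-- The two sides of the floor have different roles: 2^m₀ ≤ 1/γ makes Q' nonnegative up to m₀, while
1/γ < 2^(m₀+1) controls the tail beyond m₀. -/
lemma two_pow_mZero_le {γ : I} (h0 : 0 < (γ : ℝ)) (h1 : (γ : ℝ) ≤ 1 / 2) :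
    (2 : ℝ) ^ mZero γ ≤ 1 / γ := by
  have hge : 1 ≤ 1 / (γ : ℝ) := by rw [le_div_iff₀ h0]; linarith
  have hl : 0 ≤ Real.logb 2 (1 / (γ : ℝ)) := Real.logb_nonneg (by norm_num) hge
  have := Nat.floor_le hl
  rw [Real.le_logb_iff_rpow_le (by norm_num) (by positivity), Real.rpow_natCast] at this
  exact this

lemma lt_two_pow_mZero {γ : I} (h0 : 0 < (γ : ℝ)) : 1 / (γ : ℝ) < 2 ^ (mZero γ + 1) := by
  have := Nat.lt_floor_add_one (Real.logb 2 (1 / (γ : ℝ)))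
  rw [Real.logb_lt_iff_lt_rpow (by norm_num) (by positivity)] at this
  have h : ((⌊Real.logb 2 (1 / (γ : ℝ))⌋₊ : ℝ) + 1) = ((mZero γ + 1 : ℕ) : ℝ) := by
    simp [mZero]
  rwa [h, Real.rpow_natCast] at this

lemma one_le_mZero {γ : I} (h0 : 0 < (γ : ℝ)) (h1 : (γ : ℝ) ≤ 1 / 2) : 1 ≤ mZero γ := by
  refine Nat.le_floor ?_
  rw [Real.le_logb_iff_rpow_le (by norm_num) (by positivity), le_div_iff₀ h0]
  norm_num
  linarith

lemma binomMass_double_le {p q : I} (hp : (p : ℝ) = 2 * q) (M m : ℕ) :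
    binomMass M p m ≤ 2 ^ m * binomMass M q m := by
  rw [binomMass_eq, binomMass_eq, hp, mul_pow]
  have hq0 : (0 : ℝ) ≤ q := q.2.1
  have hp1 : (0 : ℝ) ≤ 1 - 2 * q := by rw [← hp]; exact sub_nonneg.2 p.2.2
  have : (1 - 2 * (q : ℝ)) ^ (M - m) ≤ (1 - q) ^ (M - m) := by gcongr; linarith
  calc _ ≤ (M.choose m : ℝ) * (2 ^ m * (q : ℝ) ^ m) * (1 - q) ^ (M - m) := by gcongr
    _ = _ := by ring

/-- The geometric bound for a difference of masses in the tail. -/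
lemma abs_tail_le {γ p q : I} (h0 : 0 < (γ : ℝ)) (hp : (p : ℝ) = 2 * q) (M : ℕ) {j : ℕ}
    (hj : mZero γ < j) :
    |binomMass M p j - 1 / (γ : ℝ) * binomMass M q j| ≤ (2 * M * (q : ℝ)) ^ j := by
  have hq0 : (0 : ℝ) ≤ q := q.2.1
  have hP := binomMass_le_pow M p j
  have hQ := binomMass_le_pow M q j
  rw [hp] at hP
  have e1 : (M : ℝ) * (2 * q) = 2 * M * q := by ring
  rw [e1] at hP
  have h2 : 1 / (γ : ℝ) ≤ 2 ^ j :=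
    (lt_two_pow_mZero h0).le.trans (pow_le_pow_right₀ (by norm_num) hj)
  have hQ' : 1 / (γ : ℝ) * binomMass M q j ≤ (2 * M * (q : ℝ)) ^ j := by
    calc _ ≤ 2 ^ j * (M * (q : ℝ)) ^ j := by
          have := binomMass_nonneg M q j
          gcongr
      _ = _ := by rw [← mul_pow]; ring
  have n1 := binomMass_nonneg M p j
  have n2 : 0 ≤ 1 / (γ : ℝ) * binomMass M q j :=
    mul_nonneg (by positivity) (binomMass_nonneg M q j)
  rw [abs_le]
  constructor <;> linarith

lemma sum_pow_Ioc_le {x : ℝ} (hx0 : 0 ≤ x) (hx : x ≤ 1 / 2) (m M : ℕ) :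
    ∑ j ∈ Finset.Ioc m M, x ^ j ≤ 2 * x ^ (m + 1) := by
  have e : Finset.Ioc m M = Finset.Ico (m + 1) (M + 1) := by ext; simp
  rw [e]
  refine (geom_sum_Ico_le_of_lt_one hx0 (by linarith)).trans ?_
  rw [div_le_iff₀ (by linarith)]
  have : 0 ≤ x ^ (m + 1) := by positivity
  nlinarith

/-- This is the shape of P' - P (see `massP_sub`): a correction at 0, nothing up to m₀, the tail
differences above. It is applied to the signed differences, where everything cancels, and to their
absolute values, where the tail is counted twice. -/
lemma sum_range_tail {m₀ M : ℕ} (c : ℝ) (R : ℕ → ℝ) :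
    ∑ m ∈ Finset.range (M + 1), (if m = 0 then c else if m ≤ m₀ then 0 else R m) =
      c + ∑ j ∈ Finset.Ioc m₀ M, R j := by
  have e : Finset.range (M + 1) = insert 0 (Finset.Ioc 0 M) := by ext; simp
  rw [e, Finset.sum_insert (by simp), if_pos rfl]
  congr 1
  have : ∀ m ∈ Finset.Ioc 0 M, (if m = 0 then c else if m ≤ m₀ then 0 else R m) =
      if m₀ < m then R m else 0 := by
    intro m hm
    have : m ≠ 0 := by simp at hm; omega
    rw [if_neg this]
    split_ifs <;> first | rfl | omega
  rw [Finset.sum_congr rfl this, ← Finset.sum_filter]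
  refine Finset.sum_congr ?_ fun _ _ => rfl
  ext; simp; omega

lemma massP_sub (γ p q : I) (a b m : ℕ) :
    massP γ p q a b m - binomMass (a * b) p m =
      if m = 0 then ∑ j ∈ Finset.Ioc (mZero γ) (a * b),
        (binomMass (a * b) p j - 1 / (γ : ℝ) * binomMass (a * b) q j)
      else if m ≤ mZero γ then 0
      else -(binomMass (a * b) p m - 1 / (γ : ℝ) * binomMass (a * b) q m) := by
  unfold massP
  split_ifs with h1 h2
  · subst h1; ring
  · ring
  · ring

lemma massP_eq_zero {γ p q : I} {a b m : ℕ} (h : a * b < m) : massP γ p q a b m = 0 := by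
  unfold massP
  rw [if_neg (by omega), binomMass_eq_zero _ h, binomMass_eq_zero _ h]
  simp

lemma sum_massP (γ p q : I) (a b : ℕ) :
    ∑ m ∈ Finset.range (a * b + 1), massP γ p q a b m = 1 := by
  have := sum_range_tail (m₀ := mZero γ) (M := a * b)
    (∑ j ∈ Finset.Ioc (mZero γ) (a * b),
      (binomMass (a * b) p j - 1 / (γ : ℝ) * binomMass (a * b) q j))
    (fun m => -(binomMass (a * b) p m - 1 / (γ : ℝ) * binomMass (a * b) q m))
  rw [Finset.sum_neg_distrib, add_neg_cancel] at this
  simp_rw [← massP_sub] at this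
  rw [Finset.sum_sub_distrib, sum_binomMass] at this
  linarith

lemma tail_sum_le {γ p q : I} (h0 : 0 < (γ : ℝ)) (hp : (p : ℝ) = 2 * q) {M : ℕ} {x : ℝ}
    (hx : 2 * M * (q : ℝ) ≤ x) (hx2 : x ≤ 1 / 2) :
    ∑ j ∈ Finset.Ioc (mZero γ) M, |binomMass M p j - 1 / (γ : ℝ) * binomMass M q j| ≤
      2 * x ^ (mZero γ + 1) := by
  have hq0 : (0 : ℝ) ≤ q := q.2.1
  have hx0 : 0 ≤ 2 * M * (q : ℝ) := by positivity
  calc _ ≤ ∑ j ∈ Finset.Ioc (mZero γ) M, x ^ j := by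
        refine Finset.sum_le_sum fun j hj => ?_
        refine (abs_tail_le h0 hp M (Finset.mem_Ioc.1 hj).1).trans ?_
        gcongr
    _ ≤ _ := sum_pow_Ioc_le (hx0.trans hx) hx2 _ _

lemma sum_abs_massP_sub_le {γ p q : I} (h0 : 0 < (γ : ℝ)) (hp : (p : ℝ) = 2 * q) {a b : ℕ} {x : ℝ}
    (hx : 2 * (a * b : ℕ) * (q : ℝ) ≤ x) (hx2 : x ≤ 1 / 2) :
    ∑ m ∈ Finset.range (a * b + 1), |massP γ p q a b m - binomMass (a * b) p m| ≤
      4 * x ^ (mZero γ + 1) := by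
  have := sum_range_tail (m₀ := mZero γ) (M := a * b)
    |∑ j ∈ Finset.Ioc (mZero γ) (a * b),
      (binomMass (a * b) p j - 1 / (γ : ℝ) * binomMass (a * b) q j)|
    (fun m => |binomMass (a * b) p m - 1 / (γ : ℝ) * binomMass (a * b) q m|)
  have e : ∀ m, |massP γ p q a b m - binomMass (a * b) p m| =
      if m = 0 then |∑ j ∈ Finset.Ioc (mZero γ) (a * b),
        (binomMass (a * b) p j - 1 / (γ : ℝ) * binomMass (a * b) q j)|
      else if m ≤ mZero γ then 0
      else |binomMass (a * b) p m - 1 / (γ : ℝ) * binomMass (a * b) q m| := by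
    intro m
    rw [massP_sub]
    split_ifs <;> simp [abs_sub_comm]
  simp_rw [e]
  rw [this]
  have h1 := Finset.abs_sum_le_sum_abs
    (fun j => binomMass (a * b) p j - 1 / (γ : ℝ) * binomMass (a * b) q j)
    (Finset.Ioc (mZero γ) (a * b))
  have h2 := tail_sum_le h0 hp hx hx2
  linarith

lemma one_sub_le_binomMass_zero (M : ℕ) (p : I) : 1 - M * (p : ℝ) ≤ binomMass M p 0 := by
  have h := one_add_mul_le_pow (a := -(p : ℝ)) (by linarith [p.2.2]) M
  simp only [binomMass_eq, Nat.choose_zero_right, pow_zero, Nat.sub_zero]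
  rw [← sub_eq_add_neg] at h
  push_cast
  linarith

/-- Only the mass at 0 is in doubt. There P(0) ≥ 1 - 2abq ≥ 1/2, and the correction is at most
2·(1/2)^(m₀+1) ≤ 1/2 because m₀ ≥ 1, which is where γ ≤ 1/2 enters. -/
lemma massP_nonneg {γ p q : I} (h0 : 0 < (γ : ℝ)) (h1 : (γ : ℝ) ≤ 1 / 2) (hp : (p : ℝ) = 2 * q)
    {a b : ℕ} (hx : 2 * (a * b : ℕ) * (q : ℝ) ≤ 1 / 2) (m : ℕ) : 0 ≤ massP γ p q a b m := by
  unfold massP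
  split_ifs
  · have h2 : 1 - (a * b : ℕ) * (p : ℝ) ≤ binomMass (a * b) p 0 := one_sub_le_binomMass_zero _ _
    rw [hp] at h2
    have h3 := tail_sum_le h0 hp hx le_rfl
    have h4 := Finset.abs_sum_le_sum_abs
      (fun j => binomMass (a * b) p j - 1 / (γ : ℝ) * binomMass (a * b) q j)
      (Finset.Ioc (mZero γ) (a * b))
    have h5 : (1 / 2 : ℝ) ^ (mZero γ + 1) ≤ (1 / 2) ^ 2 :=
      pow_le_pow_of_le_one (by norm_num) (by norm_num) (by have := one_le_mZero h0 h1; omega)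
    have h6 := (abs_le.1 (h4.trans h3)).1
    nlinarith
  · exact binomMass_nonneg _ _ _
  · exact mul_nonneg (by positivity) (binomMass_nonneg _ _ _)

/-- At 0 the left side is at most γ ≤ 1/2, and Q(0) ≥ 1 - abq ≥ 3/4. For 1 ≤ m ≤ m₀ it follows from
P(m) ≤ 2^m Q(m), and above m₀ there is equality. -/
lemma mul_massP_le {γ p q : I} (h0 : 0 < (γ : ℝ)) (h1 : (γ : ℝ) ≤ 1 / 2) (hp : (p : ℝ) = 2 * q)
    {a b : ℕ} (hx : 2 * (a * b : ℕ) * (q : ℝ) ≤ 1 / 2) (m : ℕ) :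
    γ * massP γ p q a b m ≤ binomMass (a * b) q m := by
  rcases Nat.eq_zero_or_pos m with rfl | hm
  · have h2 := one_sub_le_binomMass_zero (a * b) q
    have h3 : massP γ p q a b 0 ≤ 1 := by
      rw [← sum_massP γ p q a b]
      exact Finset.single_le_sum (f := massP γ p q a b)
        (fun m _ => massP_nonneg h0 h1 hp hx m) (by simp)
    nlinarith [massP_nonneg h0 h1 hp hx 0]
  · unfold massP
    rw [if_neg (by omega)]
    split_ifs with h
    · have h2 := binomMass_double_le hp (a * b) m
      have h3 : (2 : ℝ) ^ m ≤ 1 / γ :=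
        (pow_le_pow_right₀ (by norm_num) h).trans (two_pow_mZero_le h0 h1)
      have h4 := binomMass_nonneg (a * b) q m
      calc (γ : ℝ) * binomMass (a * b) p m ≤ γ * (1 / γ * binomMass (a * b) q m) := by
            gcongr
            exact h2.trans (by gcongr)
        _ = _ := by field_simp
    · apply le_of_eq
      field_simp

lemma isMassFunction_massP {γ p q : I} (h0 : 0 < (γ : ℝ)) (h1 : (γ : ℝ) ≤ 1 / 2)
    (hp : (p : ℝ) = 2 * q) {a b : ℕ} (hx : 2 * (a * b : ℕ) * (q : ℝ) ≤ 1 / 2) :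
    IsMassFunction (massP γ p q a b) := by
  refine ⟨massP_nonneg h0 h1 hp hx, ?_⟩
  rw [← sum_massP γ p q a b]
  exact hasSum_sum_of_ne_finset_zero fun m hm => massP_eq_zero (by simpa using hm)

lemma mix_massP_massQ {γ : I} (h1 : (γ : ℝ) ≤ 1 / 2) (p q : I) (a b m : ℕ) :
    γ * massP γ p q a b m + (1 - γ) * massQ γ p q a b m = binomMass (a * b) q m := by
  have : (1 - (γ : ℝ)) ≠ 0 := by linarith
  unfold massQ
  field_simp
  ring

lemma isMassFunction_massQ {γ p q : I} (h0 : 0 < (γ : ℝ)) (h1 : (γ : ℝ) ≤ 1 / 2)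
    (hp : (p : ℝ) = 2 * q) {a b : ℕ} (hx : 2 * (a * b : ℕ) * (q : ℝ) ≤ 1 / 2) :
    IsMassFunction (massQ γ p q a b) := by
  have hγ : 0 < 1 - (γ : ℝ) := by linarith
  refine ⟨fun m => mul_nonneg (by positivity) (sub_nonneg.2 (mul_massP_le h0 h1 hp hx m)), ?_⟩
  have : ∑ m ∈ Finset.range (a * b + 1), massQ γ p q a b m = 1 := by
    unfold massQ
    rw [← Finset.mul_sum, Finset.sum_sub_distrib, ← Finset.mul_sum, sum_binomMass, sum_massP]
    field_simp
  rw [← this]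
  refine hasSum_sum_of_ne_finset_zero fun m hm => ?_
  have : a * b < m := by simpa using hm
  rw [massQ, massP_eq_zero this, binomMass_eq_zero _ this]
  simp

lemma two_mul_mul_le {ℓ a b : ℕ} {q : ℝ} (hq : 0 ≤ q) (ha : a ≤ 2 * ℓ) (hb : b ≤ 2 * ℓ) :
    2 * ((a * b : ℕ) : ℝ) * q ≤ 8 * q * (ℓ : ℝ) ^ 2 := by
  have : ((a * b : ℕ) : ℝ) ≤ ((2 * ℓ * (2 * ℓ) : ℕ) : ℝ) := by
    exact_mod_cast Nat.mul_le_mul ha hb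
  push_cast at this ⊢
  nlinarith

/-! ### Product laws on sets and graphs -/

open Classical in
lemma sum_set_prod {α : Type*} [Fintype α] [Fintype (Set α)] (φ : α → Prop → ℝ) :
    ∑ Z : Set α, ∏ e, φ e (e ∈ Z) = ∏ e, (φ e True + φ e False) := by
  have h := Finset.prod_univ_sum (fun _ : α => (Finset.univ : Finset Prop)) φ
  simp only [Fintype.univ_Prop] at h
  have e1 : ∏ e, (φ e True + φ e False) = ∏ e, ∑ b ∈ ({True, False} : Finset Prop), φ e b := by
    refine Finset.prod_congr rfl fun e _ => ?_
    rw [Finset.sum_pair (by simp)]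
  rw [e1]
  have h' : ∏ e, ∑ b ∈ ({True, False} : Finset Prop), φ e b = ∑ x : α → Prop, ∏ i, φ i (x i) := by
    rw [h]
    refine Finset.sum_congr ?_ fun _ _ => rfl
    ext x
    simpa [Fintype.mem_piFinset] using fun a => Classical.em (x a)
  rw [h']
  refine Finset.sum_bij' (fun Z _ => fun e => e ∈ Z) (fun x _ => {e | x e}) ?_ ?_ ?_ ?_ ?_ <;> simp

open Classical in
/-- The potential edges of a graph. -/
noncomputable def potentialEdges (V : Type*) [Fintype V] : Finset (Sym2 V) :=
  Finset.univ.filter fun e => ¬ e.IsDiag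

@[simp] lemma mem_potentialEdges {V : Type*} [Fintype V] {e : Sym2 V} :
    e ∈ potentialEdges V ↔ ¬ e.IsDiag := by simp [potentialEdges]

open Classical in
lemma sum_graph_prod {V : Type*} [Fintype V] [Fintype (SimpleGraph V)] (φ : Sym2 V → Prop → ℝ) :
    ∑ H : SimpleGraph V, ∏ e ∈ potentialEdges V, φ e (e ∈ H.edgeSet) =
      ∏ e ∈ potentialEdges V, (φ e True + φ e False) := by
  -- Loops get weight 0 when present and 1 when absent, so only edge sets of graphs contribute to
  -- the sum over all sets of pairs.
  have h := sum_set_prod (fun e b => if e.IsDiag then (if b then 0 else 1) else φ e b)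
  have e1 : ∏ e : Sym2 V, ((if e.IsDiag then (if True then 0 else 1) else φ e True) +
      (if e.IsDiag then (if False then 0 else 1) else φ e False)) =
      ∏ e ∈ potentialEdges V, (φ e True + φ e False) := by
    rw [potentialEdges, Finset.prod_filter]
    refine Finset.prod_congr rfl fun e _ => ?_
    by_cases he : e.IsDiag <;> simp [he]
  rw [← e1]
  refine Eq.trans ?_ (h.trans (Finset.prod_congr rfl fun e _ => by by_cases he : e.IsDiag <;> simp [he]))
  refine Finset.sum_of_injOn SimpleGraph.edgeSet SimpleGraph.edgeSet_injective.injOn (by simp) ?_ ?_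
  · intro Z _ hZ
    by_contra hne
    apply hZ
    refine ⟨SimpleGraph.fromEdgeSet Z, by simp, ?_⟩
    rw [SimpleGraph.edgeSet_fromEdgeSet]
    refine sdiff_eq_left.2 (Set.disjoint_left.2 fun e he hd => hne ?_)
    refine Finset.prod_eq_zero (Finset.mem_univ e) ?_
    simp only [he, if_true]
    exact if_pos hd
  · intro H _
    rw [potentialEdges, Finset.prod_filter]
    refine Finset.prod_congr rfl fun e _ => ?_
    by_cases he : e.IsDiag
    · have : e ∉ H.edgeSet := fun h => H.not_isDiag_of_mem_edgeSet h he
      simp [he, this]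
    · simp [he]

open Classical in
/-- The mass of `H` under the random graph with independent edges of probabilities `r e`. -/
noncomputable def edgeLaw {V : Type*} [Fintype V] (r : Sym2 V → ℝ) (H : SimpleGraph V) : ℝ :=
  ∏ e ∈ potentialEdges V, if e ∈ H.edgeSet then r e else 1 - r e

lemma sum_edgeLaw {V : Type*} [Fintype V] [Fintype (SimpleGraph V)] (r : Sym2 V → ℝ) :
    ∑ H, edgeLaw r H = 1 := by
  classical
  have h := sum_graph_prod (V := V) (fun e b => if b then r e else 1 - r e)
  simp only [if_true, if_false, add_sub_cancel, Finset.prod_const_one] at h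
  rw [← h]
  refine Finset.sum_congr rfl fun H _ => Finset.prod_congr rfl fun e _ => ?_
  split_ifs <;> rfl

lemma edgeLaw_nonneg {V : Type*} [Fintype V] {r : Sym2 V → ℝ} (h0 : ∀ e, 0 ≤ r e)
    (h1 : ∀ e, r e ≤ 1) (H : SimpleGraph V) : 0 ≤ edgeLaw r H := by
  refine Finset.prod_nonneg fun e _ => ?_
  have := h0 e
  have := h1 e
  split_ifs <;> linarith

lemma edgeLaw_pos {V : Type*} [Fintype V] {r : Sym2 V → ℝ} (h0 : ∀ e, 0 < r e)
    (h1 : ∀ e, r e < 1) (H : SimpleGraph V) : 0 < edgeLaw r H := by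
  refine Finset.prod_pos fun e _ => ?_
  have := h0 e
  have := h1 e
  split_ifs <;> linarith

/-- The second-moment integrand factorizes over edges; with s as reference law this is the overlap
entering the χ² computation. -/
lemma sum_edgeLaw_mul_div {V : Type*} [Fintype V] [Fintype (SimpleGraph V)]
    (r r' s : Sym2 V → ℝ) :
    ∑ H, edgeLaw r H * edgeLaw r' H / edgeLaw s H =
      ∏ e ∈ potentialEdges V, (r e * r' e / s e + (1 - r e) * (1 - r' e) / (1 - s e)) := by
  classical
  have := sum_graph_prod (V := V) (fun e b => (if b then r e else 1 - r e) *
    (if b then r' e else 1 - r' e) / (if b then s e else 1 - s e))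
  simp only [if_true, if_false] at this
  rw [← this]
  refine Finset.sum_congr rfl fun H _ => ?_
  unfold edgeLaw
  rw [← Finset.prod_mul_distrib, ← Finset.prod_div_distrib]
  refine Finset.prod_congr rfl fun e _ => ?_
  split_ifs <;> rfl

/-! ### Hybrid argument and exchangeable laws on blocks -/

/-- Hybrid argument: the factors are exchanged one at a time. When factor j is exchanged, all other
factors are nonnegative and sum to 1, so the step costs exactly the L¹ distance of the two j-th
factors. -/
lemma sum_abs_prod_sub_prod_le {ι β : Type*} [Fintype ι] [DecidableEq ι] [Fintype β]
    (a b : ι → β → ℝ) (ha : ∀ i x, 0 ≤ a i x) (hb : ∀ i x, 0 ≤ b i x)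
    (ha1 : ∀ i, ∑ x, a i x = 1) (hb1 : ∀ i, ∑ x, b i x = 1) :
    ∑ F : ι → β, |∏ i, a i (F i) - ∏ i, b i (F i)| ≤ ∑ i, ∑ x, |a i x - b i x| := by
  have key : ∀ T : Finset ι,
      ∑ F : ι → β, |∏ i, (if i ∈ T then a i (F i) else b i (F i)) - ∏ i, b i (F i)| ≤
        ∑ i ∈ T, ∑ x, |a i x - b i x| := by
    intro T
    induction T using Finset.induction_on with
    | empty => simp
    | insert j T hj ih =>
      rw [Finset.sum_insert hj]
      have step : ∑ F : ι → β, |∏ i, (if i ∈ insert j T then a i (F i) else b i (F i)) -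
          ∏ i, (if i ∈ T then a i (F i) else b i (F i))| = ∑ x, |a j x - b j x| := by
        have e : ∀ F : ι → β, |∏ i, (if i ∈ insert j T then a i (F i) else b i (F i)) -
            ∏ i, (if i ∈ T then a i (F i) else b i (F i))| =
            ∏ i, (if i = j then |a i (F i) - b i (F i)| else
              if i ∈ T then a i (F i) else b i (F i)) := by
          intro F
          rw [← Finset.mul_prod_erase _ _ (Finset.mem_univ j),
            ← Finset.mul_prod_erase _ (fun i => if i ∈ T then a i (F i) else b i (F i))
              (Finset.mem_univ j),
            ← Finset.mul_prod_erase _ (fun i => if i = j then |a i (F i) - b i (F i)| else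
              if i ∈ T then a i (F i) else b i (F i)) (Finset.mem_univ j)]
          have e1 : ∏ i ∈ Finset.univ.erase j, (if i ∈ insert j T then a i (F i) else b i (F i)) =
              ∏ i ∈ Finset.univ.erase j, (if i ∈ T then a i (F i) else b i (F i)) := by
            refine Finset.prod_congr rfl fun i hi => ?_
            have : i ≠ j := Finset.ne_of_mem_erase hi
            simp [this]
          have e2 : ∏ i ∈ Finset.univ.erase j, (if i = j then |a i (F i) - b i (F i)| else
              if i ∈ T then a i (F i) else b i (F i)) =
              ∏ i ∈ Finset.univ.erase j, (if i ∈ T then a i (F i) else b i (F i)) := by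
            refine Finset.prod_congr rfl fun i hi => ?_
            have : i ≠ j := Finset.ne_of_mem_erase hi
            simp [this]
          have e3 : 0 ≤ ∏ i ∈ Finset.univ.erase j, (if i ∈ T then a i (F i) else b i (F i)) := by
            refine Finset.prod_nonneg fun i _ => ?_
            split_ifs
            exacts [ha _ _, hb _ _]
          rw [e1, e2, if_pos (Finset.mem_insert_self j T), if_neg hj, if_pos rfl, ← sub_mul,
            abs_mul, abs_of_nonneg e3]
        simp_rw [e]
        have h := Finset.prod_univ_sum (fun _ : ι => (Finset.univ : Finset β))
          (fun i x => if i = j then |a i x - b i x| else if i ∈ T then a i x else b i x)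
        rw [Fintype.piFinset_univ] at h
        rw [← h, ← Finset.mul_prod_erase _ _ (Finset.mem_univ j)]
        have : ∏ i ∈ Finset.univ.erase j, ∑ x, (if i = j then |a i x - b i x| else
            if i ∈ T then a i x else b i x) = 1 := by
          refine Finset.prod_eq_one fun i hi => ?_
          have : i ≠ j := Finset.ne_of_mem_erase hi
          simp only [this, if_false]
          split_ifs
          exacts [ha1 i, hb1 i]
        rw [this, mul_one]
        simp
      rw [← step]
      refine le_trans ?_ (add_le_add_right ih _)
      rw [← Finset.sum_add_distrib]
      exact Finset.sum_le_sum fun F _ => abs_sub_le _ _ _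
  simpa using key Finset.univ

/-- An exchangeable law on the subsets of `B`: the size has mass function `w` and, given the size,
the set is uniform. -/
noncomputable def blockMass {α : Type*} (w : ℕ → ℝ) (B F : Set α) : ℝ :=
  open Classical in if F ⊆ B then w F.ncard / (B.ncard.choose F.ncard) else 0

lemma blockMass_nonneg {α : Type*} {w : ℕ → ℝ} (hw : ∀ m, 0 ≤ w m) (B F : Set α) :
    0 ≤ blockMass w B F := by
  unfold blockMass
  split_ifs
  · exact div_nonneg (hw _) (by positivity)
  · exact le_rfl

lemma sum_blockMass {α : Type*} [Fintype α] [Fintype (Set α)] (B : Set α) (w : ℕ → ℝ) :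
    ∑ F : Set α, blockMass w B F = ∑ m ∈ Finset.range (B.ncard + 1), w m := by
  classical
  have h := Finset.sum_powerset_apply_card (fun m => w m / (B.ncard.choose m)) (x := B.toFinset)
  rw [← Set.ncard_eq_toFinset_card'] at h
  have e : ∑ m ∈ Finset.range (B.ncard + 1), w m =
      ∑ m ∈ Finset.range (B.ncard + 1), (B.ncard.choose m) • (w m / (B.ncard.choose m)) := by
    refine Finset.sum_congr rfl fun m hm => ?_
    have : (B.ncard.choose m : ℝ) ≠ 0 := by
      have := Nat.choose_pos (Finset.mem_range_succ_iff.1 hm)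
      positivity
    rw [nsmul_eq_mul]
    field_simp
  rw [e, ← h]
  symm
  refine Finset.sum_of_injOn (fun F : Finset α => (F : Set α)) Finset.coe_injective.injOn
    (by simp) ?_ ?_
  · intro F _ hF
    unfold blockMass
    rw [if_neg]
    intro hFB
    exact hF ⟨F.toFinset, by simpa using hFB, by simp⟩
  · intro F hF
    have : (F : Set α) ⊆ B := by
      have := Finset.mem_powerset.1 hF
      intro x hx
      simpa using this hx
    simp [blockMass, this]

/-- Given the size, both laws are uniform, so the L¹ distance is seen by the size alone. -/
lemma sum_abs_blockMass_sub {α : Type*} [Fintype α] [Fintype (Set α)] (B : Set α) (w w' : ℕ → ℝ) :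
    ∑ F : Set α, |blockMass w B F - blockMass w' B F| =
      ∑ m ∈ Finset.range (B.ncard + 1), |w m - w' m| := by
  rw [← sum_blockMass B fun m => |w m - w' m|]
  refine Finset.sum_congr rfl fun F _ => ?_
  unfold blockMass
  split_ifs
  · rw [← sub_div, abs_div, abs_of_nonneg (a := ((B.ncard.choose F.ncard : ℕ) : ℝ)) (by positivity)]
  · simp

/-- The binomial coefficient in the size law cancels against the uniform choice, leaving independent
membership. This is how block counts become edge probabilities. -/
lemma blockMass_binomMass {α : Type*} [Fintype α] [DecidableEq α] (p : I) (B F : Set α)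
    [DecidablePred (· ∈ B)] [DecidablePred (· ∈ F)] :
    blockMass (binomMass B.ncard p) B (F ∩ B) =
      ∏ e ∈ B.toFinset, if e ∈ F then (p : ℝ) else 1 - p := by
  have hle : (F ∩ B).ncard ≤ B.ncard := Set.ncard_le_ncard Set.inter_subset_right
  have h0 : (B.ncard.choose (F ∩ B).ncard : ℝ) ≠ 0 := by
    have := Nat.choose_pos hle
    positivity
  unfold blockMass
  rw [if_pos Set.inter_subset_right, binomMass_eq, Finset.prod_ite, Finset.prod_const,
    Finset.prod_const]
  have e1 : (F ∩ B).ncard = (B.toFinset.filter (· ∈ F)).card := by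
    rw [← Set.ncard_coe_finset]
    congr 1
    ext; simp [and_comm]
  have e2 : B.ncard - (F ∩ B).ncard = (B.toFinset.filter (· ∉ F)).card := by
    have := Finset.card_filter_add_card_filter_not (s := B.toFinset) (· ∈ F)
    rw [← Set.ncard_eq_toFinset_card'] at this
    omega
  rw [e2, ← e1]
  field_simp

/-! ### Point masses of binds, maps and Bernoulli sets on finite spaces -/

instance instMeasurableSingletonClassSimpleGraph {V : Type*} [Countable V] :
    MeasurableSingletonClass (SimpleGraph V) where
  measurableSet_singleton G := by
    have : ({G} : Set (SimpleGraph V)) = SimpleGraph.edgeSet ⁻¹' {G.edgeSet} := by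
      ext H; simp
    rw [this]
    exact SimpleGraph.measurableEmbedding_edgeSet.measurable (measurableSet_singleton _)

section Bind

variable {α β : Type*} [MeasurableSpace α] [MeasurableSpace β] [MeasurableSingletonClass α]
  [Fintype α]

lemma isFiniteMeasure_bind_fintype (μ : Measure α) [IsFiniteMeasure μ] (κ : α → Measure β)
    [∀ a, IsFiniteMeasure (κ a)] : IsFiniteMeasure (μ.bind κ) := by
  refine ⟨?_⟩
  rw [Measure.bind_apply MeasurableSet.univ (Measurable.of_discrete).aemeasurable,
    lintegral_fintype]
  exact ENNReal.sum_lt_top.2 fun a _ => ENNReal.mul_lt_top (measure_lt_top _ _) (measure_lt_top _ _)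

lemma bind_real_apply (μ : Measure α) [IsFiniteMeasure μ] (κ : α → Measure β)
    [∀ a, IsFiniteMeasure (κ a)] {s : Set β} (hs : MeasurableSet s) :
    (μ.bind κ).real s = ∑ a, μ.real {a} * (κ a).real s := by
  rw [measureReal_def, Measure.bind_apply hs (Measurable.of_discrete).aemeasurable,
    lintegral_fintype, ENNReal.toReal_sum fun a _ =>
      ENNReal.mul_ne_top (measure_ne_top _ _) (measure_ne_top _ _)]
  refine Finset.sum_congr rfl fun a _ => ?_
  rw [ENNReal.toReal_mul, mul_comm]
  rfl

open Classical in
lemma map_real_singleton (μ : Measure α) [IsFiniteMeasure μ] [MeasurableSingletonClass β]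
    (g : α → β) (b : β) :
    (μ.map g).real {b} = ∑ a, if g a = b then μ.real {a} else 0 := by
  rw [map_measureReal_apply Measurable.of_discrete (measurableSet_singleton b),
    ← Finset.sum_filter, sum_measureReal_singleton]
  congr 1
  ext a
  simp

lemma map_bind_real_apply {δ : Type*} [MeasurableSpace δ] [MeasurableSingletonClass β] [Fintype β]
    (μ : Measure α) [IsFiniteMeasure μ]
    (g : α → β) (κ : β → Measure δ) [∀ a, IsFiniteMeasure (κ a)] {s : Set δ}
    (hs : MeasurableSet s) :
    ((μ.map g).bind κ).real s = ∑ a, μ.real {a} * (κ (g a)).real s := by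
  classical
  rw [bind_real_apply _ _ hs]
  simp_rw [map_real_singleton, Finset.sum_mul]
  rw [Finset.sum_comm]
  refine Finset.sum_congr rfl fun a _ => ?_
  simp

open Classical in
lemma uniformOn_real_singleton (s : Set α) (x : α) :
    (uniformOn s).real {x} = if x ∈ s then 1 / (s.ncard : ℝ) else 0 := by
  have h := uniformOn_apply_finset (s := s.toFinset) (t := {x})
  simp only [Set.coe_toFinset, Finset.coe_singleton] at h
  rw [measureReal_def, h]
  split_ifs with hx
  · rw [Finset.inter_singleton_of_mem (by simpa using hx), ENNReal.toReal_div]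
    simp [Set.ncard_eq_toFinset_card']
  · rw [Finset.inter_singleton_of_notMem (by simpa using hx)]
    simp

end Bind

lemma pi_real_singleton {ι α : Type*} [Fintype ι] [MeasurableSpace α] (μ : ι → Measure α) [∀ i, IsFiniteMeasure (μ i)]
    (x : ι → α) : (Measure.pi μ).real {x} = ∏ i, (μ i).real {x i} := by
  rw [measureReal_def, Measure.pi_singleton, ENNReal.toReal_prod]
  rfl

lemma isFiniteMeasure_uniformOn {α : Type*} [MeasurableSpace α] (s : Set α) : IsFiniteMeasure (uniformOn s) := by
  unfold uniformOn
  infer_instance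

lemma binomialRandom_real_singleton {V : Type*} [Fintype V] (q : I) (H : SimpleGraph V) :
    (SimpleGraph.binomialRandom V q).real {H} = edgeLaw (fun _ => (q : ℝ)) H := by
  classical
  have h1 : (SimpleGraph.binomialRandom V q).real {H} =
      (setBernoulli (Sym2.diagSet : Set (Sym2 V))ᶜ q).real {H.edgeSet} := by
    rw [measureReal_def, SimpleGraph.binomialRandom_apply', Set.image_singleton]
    rfl
  rw [h1, setBernoulli_real_singleton q (by simp) (Set.toFinite _), edgeLaw, Finset.prod_ite,
    Finset.prod_const, Finset.prod_const, ← Set.ncard_coe_finset, ← Set.ncard_coe_finset]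
  congr 3
  · ext e
    simpa using fun h => H.not_isDiag_of_mem_edgeSet h
  · ext e
    simp

open Classical in
lemma setBernoulli_real_singleton_eq_prod {α : Type*} [Fintype α] (A : Set α) (p : I) (s : Set α) :
    (setBernoulli A p).real {s} =
      ∏ e, (if e ∈ A then (if e ∈ s then (p : ℝ) else 1 - p) else (if e ∈ s then 0 else 1)) := by
  by_cases hs : s ⊆ A
  · rw [setBernoulli_real_singleton p hs (Set.toFinite _), Finset.prod_ite]
    have h2 : ∏ e ∈ Finset.univ.filter (fun e => e ∉ A), (if e ∈ s then (0 : ℝ) else 1) = 1 := by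
      refine Finset.prod_eq_one fun e he => ?_
      have : e ∉ s := fun h => (Finset.mem_filter.1 he).2 (hs h)
      simp [this]
    rw [h2, mul_one, Finset.prod_ite, Finset.prod_const, Finset.prod_const,
      ← Set.ncard_coe_finset, ← Set.ncard_coe_finset]
    congr 3
    · ext e
      simpa using fun h => hs h
    · ext e
      simp
  · rw [measureReal_def, setBernoulli_singleton_of_not_subset p hs]
    obtain ⟨e, he, heA⟩ := Set.not_subset.1 hs
    symm
    refine Finset.prod_eq_zero (Finset.mem_univ e) ?_
    simp [he, heA]

open Classical in
lemma sum_set_sum_set_prod {α : Type*} [Fintype α] [Fintype (Set α)] (φ : α → Prop → Prop → ℝ) :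
    ∑ x : Set α, ∑ y : Set α, ∏ e, φ e (e ∈ x) (e ∈ y) =
      ∏ e, (φ e True True + φ e True False + (φ e False True + φ e False False)) := by
  have h : ∀ x : Set α, ∑ y : Set α, ∏ e, φ e (e ∈ x) (e ∈ y) =
      ∏ e, (φ e (e ∈ x) True + φ e (e ∈ x) False) := fun x =>
    sum_set_prod fun e b => φ e (e ∈ x) b
  simp_rw [h]
  exact sum_set_prod fun e b => φ e b True + φ e b False

open Classical in
lemma map_prod_setBernoulli_real_singleton {V : Type*} [Fintype V] (A : Set (Sym2 V)) (p q : I)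
    (H : SimpleGraph V) :
    (((setBernoulli A p).prod (setBernoulli Aᶜ q)).map
      fun x => SimpleGraph.fromEdgeSet (x.1 ∪ x.2)).real {H} =
      edgeLaw (fun e => if e ∈ A then (p : ℝ) else q) H := by
  rw [map_real_singleton, Fintype.sum_prod_type]
  -- The third factor writes the event that the union of the two sets has the edges of H as a
  -- product over pairs; loops are ignored since `fromEdgeSet` removes them.
  have h := sum_set_sum_set_prod (α := Sym2 V) (fun e b c =>
    (if e ∈ A then (if b then (p : ℝ) else 1 - p) else (if b then 0 else 1)) *
    (if e ∈ Aᶜ then (if c then (q : ℝ) else 1 - q) else (if c then 0 else 1)) *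
    (if e.IsDiag then 1 else if (b ∨ c) ↔ e ∈ H.edgeSet then 1 else 0))
  refine Eq.trans (Finset.sum_congr rfl fun x _ => Finset.sum_congr rfl fun y _ => ?_) (h.trans ?_)
  · have e2 : (setBernoulli Aᶜ q).real {y} =
        ∏ e, (if e ∈ Aᶜ then (if e ∈ y then (q : ℝ) else 1 - q) else (if e ∈ y then 0 else 1)) := by
      rw [setBernoulli_real_singleton_eq_prod]
      exact Finset.prod_congr rfl fun e _ => by split_ifs <;> rfl
    rw [Finset.prod_mul_distrib, Finset.prod_mul_distrib, ← setBernoulli_real_singleton_eq_prod,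
      ← e2]
    have e1 : ((setBernoulli A p).prod (setBernoulli Aᶜ q)).real {(x, y)} =
        (setBernoulli A p).real {x} * (setBernoulli Aᶜ q).real {y} := by
      rw [← Set.singleton_prod_singleton, measureReal_prod_prod]
    rw [e1]
    by_cases hH : SimpleGraph.fromEdgeSet (x ∪ y) = H
    · rw [if_pos hH, Finset.prod_eq_one, mul_one]
      intro e _
      subst hH
      by_cases hd : e.IsDiag <;> simp [hd]
    · rw [if_neg hH]
      symm
      by_contra hne
      apply hH
      rw [← SimpleGraph.edgeSet_inj]
      have h3 := Finset.prod_ne_zero_iff.1 (right_ne_zero_of_mul hne)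
      ext e
      have h4 := h3 e (Finset.mem_univ e)
      by_cases hd : e.IsDiag
      · have : e ∉ H.edgeSet := fun h => H.not_isDiag_of_mem_edgeSet h hd
        simp [hd, this]
      · simp only [hd, if_false, ne_eq, ite_eq_right_iff, one_ne_zero, imp_false, not_not] at h4
        simp [hd, ← h4]
  · rw [edgeLaw, potentialEdges, Finset.prod_filter]
    refine Finset.prod_congr rfl fun e _ => ?_
    by_cases hd : e.IsDiag <;> by_cases hA : e ∈ A <;> by_cases hH : e ∈ H.edgeSet <;>
      simp [hd, hA, hH]

/-! ### The output law for a fixed input graph -/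

lemma ofMass_singleton (w : ℕ → ℝ) (m : ℕ) : ofMass w {m} = ENNReal.ofReal (w m) := by
  rw [ofMass, Measure.sum_apply _ (measurableSet_singleton m), tsum_eq_single m]
  · simp
  · intro j hj
    simp [hj]

lemma ofMass_real_singleton {w : ℕ → ℝ} (hw : IsMassFunction w) (m : ℕ) :
    (ofMass w).real {m} = w m := by
  rw [measureReal_def, ofMass_singleton, ENNReal.toReal_ofReal (hw.1 m)]

lemma isFiniteMeasure_ofMass {w : ℕ → ℝ} (hw : IsMassFunction w) : IsFiniteMeasure (ofMass w) := by
  refine ⟨?_⟩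
  rw [ofMass, Measure.sum_apply _ MeasurableSet.univ]
  simp only [Measure.smul_apply, measure_univ, smul_eq_mul, mul_one]
  rw [← ENNReal.ofReal_tsum_of_nonneg hw.1 hw.2.summable]
  exact ENNReal.ofReal_lt_top

open Classical in
/-- The mass function of `edgeCountLaw`, where `b` says whether `s` and `t` are adjacent. -/
noncomputable def countMass (ℓ : ℕ) (γ p q : I) {n N : ℕ} (f : Fin N → Fin n) (s t : Fin n)
    (b : Prop) (m : ℕ) : ℝ :=
  if s = t then binomMass ((numChildren f s).choose 2) q m
  else if 2 * ℓ < max (numChildren f s) (numChildren f t) then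
    binomMass (numChildren f s * numChildren f t) q m
  else if b then massP γ p q (numChildren f s) (numChildren f t) m
  else massQ γ p q (numChildren f s) (numChildren f t) m

/-- The mass functions used by the reduction are valid. -/
def ValidMasses (ℓ : ℕ) (γ p q : I) : Prop :=
  ∀ a b : ℕ, a ≤ 2 * ℓ → b ≤ 2 * ℓ →
    IsMassFunction (massP γ p q a b) ∧ IsMassFunction (massQ γ p q a b)

section

variable {ℓ : ℕ} {γ p q : I} {n N : ℕ}

lemma isFiniteMeasure_edgeCountLaw (hv : ValidMasses ℓ γ p q) (G : SimpleGraph (Fin n))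
    (f : Fin N → Fin n) (s t : Fin n) : IsFiniteMeasure (edgeCountLaw ℓ γ p q G f s t) := by
  unfold edgeCountLaw
  split_ifs with h1 h2 h3
  · infer_instance
  · infer_instance
  · exact isFiniteMeasure_ofMass (hv _ _ (by omega) (by omega)).1
  · exact isFiniteMeasure_ofMass (hv _ _ (by omega) (by omega)).2

lemma edgeCountLaw_real_singleton (hv : ValidMasses ℓ γ p q) (G : SimpleGraph (Fin n))
    (f : Fin N → Fin n) (s t : Fin n) (m : ℕ) :
    (edgeCountLaw ℓ γ p q G f s t).real {m} = countMass ℓ γ p q f s t (G.Adj s t) m := by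
  unfold edgeCountLaw countMass
  split_ifs with h1 h2 h3
  · rfl
  · rfl
  · exact ofMass_real_singleton (hv _ _ (by omega) (by omega)).1 m
  · exact ofMass_real_singleton (hv _ _ (by omega) (by omega)).2 m

/-- The potential edges whose end vertices have the parents in `d`. -/
def blockOf (f : Fin N → Fin n) (d : Sym2 (Fin n)) : Set (Sym2 (Fin N)) :=
  {e | ¬ e.IsDiag ∧ e.map f = d}

lemma block_eq_blockOf (f : Fin N → Fin n) (s t : Fin n) : block f s t = blockOf f s(s, t) := by
  ext e
  constructor
  · rintro ⟨i, j, hij, rfl, rfl, rfl⟩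
    exact ⟨by simpa using hij, by simp⟩
  · induction e with | _ i j
    rintro ⟨h1, h2⟩
    rw [Sym2.map_mk, Sym2.eq_iff] at h2
    rcases h2 with h2 | h2
    · exact ⟨i, j, by simpa using h1, h2.1, h2.2, rfl⟩
    · exact ⟨j, i, by simpa [eq_comm] using h1, h2.2, h2.1, Sym2.eq_swap⟩

lemma ncard_block_self (f : Fin N → Fin n) (s : Fin n) :
    (block f s s).ncard = (numChildren f s).choose 2 := by
  classical
  have h := Sym2.card_image_offDiag (f ⁻¹' {s}).toFinset
  rw [← Set.ncard_eq_toFinset_card', ← Set.ncard_coe_finset] at h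
  rw [numChildren, ← h]
  congr 1
  ext e
  simp only [block, Set.mem_ofPred_eq, Finset.coe_image, Set.mem_image, Finset.mem_coe,
    Finset.mem_offDiag, Set.mem_toFinset, Set.mem_preimage, Set.mem_singleton_iff, Prod.exists,
    Function.uncurry]
  constructor
  · rintro ⟨i, j, h1, h2, h3, rfl⟩
    exact ⟨i, j, ⟨h2, h3, h1⟩, rfl⟩
  · rintro ⟨i, j, ⟨h2, h3, h1⟩, rfl⟩
    exact ⟨i, j, h1, h2, h3, rfl⟩

lemma ncard_block_of_ne (f : Fin N → Fin n) {s t : Fin n} (hst : s ≠ t) :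
    (block f s t).ncard = numChildren f s * numChildren f t := by
  rw [numChildren, numChildren, ← Set.ncard_prod]
  have : block f s t = (fun x : Fin N × Fin N => s(x.1, x.2)) '' ((f ⁻¹' {s}) ×ˢ (f ⁻¹' {t})) := by
    ext e
    constructor
    · rintro ⟨i, j, _, h2, h3, rfl⟩
      exact ⟨(i, j), ⟨h2, h3⟩, rfl⟩
    · rintro ⟨⟨i, j⟩, ⟨h2, h3⟩, rfl⟩
      simp only [Set.mem_preimage, Set.mem_singleton_iff] at h2 h3
      refine ⟨i, j, ?_, h2, h3, rfl⟩
      rintro rfl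
      exact hst (h2.symm.trans h3)
  rw [this, Set.InjOn.ncard_image]
  rintro ⟨i, j⟩ ⟨h2, h3⟩ ⟨i', j'⟩ ⟨h2', h3'⟩ he
  simp only [Set.mem_preimage, Set.mem_singleton_iff] at h2 h3 h2' h3'
  rcases Sym2.eq_iff.1 he with h | h
  · exact Prod.ext h.1 h.2
  · exact absurd (h2.symm.trans ((congrArg f h.1).trans h3')) hst

lemma isFiniteMeasure_blockLaw (hv : ValidMasses ℓ γ p q) (G : SimpleGraph (Fin n))
    (f : Fin N → Fin n) (s t : Fin n) : IsFiniteMeasure (blockLaw ℓ γ p q G f s t) := by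
  have := isFiniteMeasure_edgeCountLaw hv G f s t
  refine ⟨?_⟩
  rw [blockLaw, Measure.bind_apply MeasurableSet.univ (Measurable.of_discrete).aemeasurable]
  refine lt_of_le_of_lt (lintegral_mono (g := fun _ => 1) fun m => ?_) ?_
  -- For m larger than the block there is no subset of that size and `uniformOn` is the zero
  -- measure, so the kernel is only sub-Markov.
  · rcases Set.eq_empty_or_nonempty {F' | F' ⊆ block f s t ∧ F'.ncard = m} with h | h
    · simp [h]
    · have := isProbabilityMeasure_uniformOn (Set.toFinite _) h
      exact prob_le_one
  · simp [measure_lt_top]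

lemma blockLaw_real_singleton (hv : ValidMasses ℓ γ p q) (G : SimpleGraph (Fin n))
    (f : Fin N → Fin n) (s t : Fin n) (F : Set (Sym2 (Fin N))) :
    (blockLaw ℓ γ p q G f s t).real {F} =
      blockMass (countMass ℓ γ p q f s t (G.Adj s t)) (block f s t) F := by
  classical
  have := isFiniteMeasure_edgeCountLaw hv G f s t
  -- Only the count m = |F| can produce F, so the integrand is the indicator of a single point.
  have h1 : ∀ m, uniformOn {F' | F' ⊆ block f s t ∧ F'.ncard = m} {F} =
      ({F.ncard} : Set ℕ).indicator
        (fun _ => ENNReal.ofReal (if F ⊆ block f s t then 1 / ((block f s t).ncard.choose F.ncard)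
          else 0)) m := by
    intro m
    have hfin := isFiniteMeasure_uniformOn {F' | F' ⊆ block f s t ∧ F'.ncard = m}
    rw [← ENNReal.ofReal_toReal (measure_ne_top _ _), ← measureReal_def, uniformOn_real_singleton,
      Set.ncard_powerset_ncard (Set.toFinite _)]
    by_cases hm : m = F.ncard
    · subst hm
      simp
    · have : F.ncard ≠ m := fun h => hm h.symm
      simp [hm, this]
  rw [measureReal_def, blockLaw, Measure.bind_apply (measurableSet_singleton F)
    (Measurable.of_discrete).aemeasurable]
  simp_rw [h1]
  rw [lintegral_indicator_const (measurableSet_singleton _), ENNReal.toReal_mul, ← measureReal_def,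
    edgeCountLaw_real_singleton hv, blockMass]
  split_ifs
  · rw [ENNReal.toReal_ofReal (by positivity)]
    ring
  · simp

lemma isFiniteMeasure_map_pi_blockLaw (hv : ValidMasses ℓ γ p q) (G : SimpleGraph (Fin n))
    (f : Fin N → Fin n) :
    IsFiniteMeasure ((Measure.pi fun st : {st : Fin n × Fin n // st.1 ≤ st.2} =>
      blockLaw ℓ γ p q G f st.1.1 st.1.2).map fun F => SimpleGraph.fromEdgeSet (⋃ st, F st)) := by
  have := fun st : {st : Fin n × Fin n // st.1 ≤ st.2} =>
    isFiniteMeasure_blockLaw hv G f st.1.1 st.1.2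
  infer_instance

/-- The blocks with s ≤ t partition the non-loop pairs, so the only family of subsets of blocks
whose union is H consists of the traces of H. -/
lemma sum_families_eq_prod (f : Fin N → Fin n) (H : SimpleGraph (Fin N))
    (w : {st : Fin n × Fin n // st.1 ≤ st.2} → ℕ → ℝ) [DecidableEq (SimpleGraph (Fin N))]
    [Fintype ({st : Fin n × Fin n // st.1 ≤ st.2} → Set (Sym2 (Fin N)))] :
    ∑ F : {st : Fin n × Fin n // st.1 ≤ st.2} → Set (Sym2 (Fin N)),
      (if SimpleGraph.fromEdgeSet (⋃ st, F st) = H then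
        ∏ st, blockMass (w st) (block f st.1.1 st.1.2) (F st) else 0) =
      ∏ st, blockMass (w st) (block f st.1.1 st.1.2) (H.edgeSet ∩ block f st.1.1 st.1.2) := by
  classical
  rw [Finset.sum_eq_single (fun st => H.edgeSet ∩ block f st.1.1 st.1.2)]
  · rw [if_pos]
    rw [← SimpleGraph.edgeSet_inj]
    ext e
    simp only [SimpleGraph.edgeSet_fromEdgeSet, Set.mem_sdiff, Set.mem_iUnion, Set.mem_inter_iff]
    constructor
    · rintro ⟨⟨_, h, _⟩, _⟩
      exact h
    · intro he
      have hd := H.not_isDiag_of_mem_edgeSet he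
      refine ⟨⟨Sym2.sortEquiv (e.map f), he, ?_⟩, hd⟩
      rw [block_eq_blockOf]
      exact ⟨hd, (Sym2.sortEquiv.symm_apply_apply (e.map f)).symm⟩
  · intro F _ hne
    split_ifs with hF
    · by_contra h0
      apply hne
      have hsub : ∀ st, F st ⊆ block f st.1.1 st.1.2 := by
        intro st
        by_contra hst
        exact Finset.prod_ne_zero_iff.1 h0 st (Finset.mem_univ st) (by rw [blockMass, if_neg hst])
      funext st
      ext e
      rw [← hF, SimpleGraph.edgeSet_fromEdgeSet]
      simp only [Set.mem_sdiff, Set.mem_iUnion, Set.mem_inter_iff]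
      constructor
      · intro he
        have hb := hsub st he
        refine ⟨⟨⟨st, he⟩, ?_⟩, hb⟩
        rw [block_eq_blockOf] at hb
        exact hb.1
      · rintro ⟨⟨⟨st', he⟩, _⟩, hb⟩
        have hb' := hsub st' he
        rw [block_eq_blockOf] at hb hb'
        have : st = st' := Sym2.sortEquiv.symm.injective (hb.2.symm.trans hb'.2)
        rwa [this]
    · rfl
  · simp

lemma map_pi_blockLaw_real_singleton (hv : ValidMasses ℓ γ p q) (G : SimpleGraph (Fin n))
    (f : Fin N → Fin n) (H : SimpleGraph (Fin N)) :
    ((Measure.pi fun st : {st : Fin n × Fin n // st.1 ≤ st.2} =>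
      blockLaw ℓ γ p q G f st.1.1 st.1.2).map
        fun F => SimpleGraph.fromEdgeSet (⋃ st, F st)).real {H} =
      ∏ d : Sym2 (Fin n), blockMass (countMass ℓ γ p q f d.inf d.sup (d ∈ G.edgeSet))
        (blockOf f d) (H.edgeSet ∩ blockOf f d) := by
  classical
  have := fun st : {st : Fin n × Fin n // st.1 ≤ st.2} =>
    isFiniteMeasure_blockLaw hv G f st.1.1 st.1.2
  rw [map_real_singleton]
  simp_rw [pi_real_singleton, blockLaw_real_singleton hv]
  rw [sum_families_eq_prod f H fun st => countMass ℓ γ p q f st.1.1 st.1.2 (G.Adj st.1.1 st.1.2)]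
  symm
  -- Ordered pairs s ≤ t are reindexed by unordered pairs, which are also what indexes the edges of
  -- the input graph.
  refine Fintype.prod_equiv Sym2.sortEquiv _ _ fun d => ?_
  have hd : d = s(d.inf, d.sup) := (Sym2.sortEquiv.symm_apply_apply d).symm
  have hb : block f (Sym2.sortEquiv d).1.1 (Sym2.sortEquiv d).1.2 = blockOf f d := by
    rw [block_eq_blockOf]
    congr 1
    exact hd.symm
  have ha : G.Adj (Sym2.sortEquiv d).1.1 (Sym2.sortEquiv d).1.2 = (d ∈ G.edgeSet) := by
    conv_rhs => rw [hd]
    rfl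
  rw [hb, ha]
  rfl

lemma isFiniteMeasure_reduction (hv : ValidMasses ℓ γ p q) (G : SimpleGraph (Fin n)) :
    IsFiniteMeasure (reduction ℓ γ p q N G) := by
  have := isFiniteMeasure_uniformOn (Set.univ : Set (Fin n))
  have := fun f : Fin N → Fin n => isFiniteMeasure_map_pi_blockLaw hv G f
  exact isFiniteMeasure_bind_fintype _ _

lemma reduction_real_singleton (hv : ValidMasses ℓ γ p q) (G : SimpleGraph (Fin n))
    (H : SimpleGraph (Fin N)) :
    (reduction ℓ γ p q N G).real {H} = ∑ f : Fin N → Fin n, (1 / (n : ℝ)) ^ N *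
      ∏ d : Sym2 (Fin n), blockMass (countMass ℓ γ p q f d.inf d.sup (d ∈ G.edgeSet))
        (blockOf f d) (H.edgeSet ∩ blockOf f d) := by
  have := isFiniteMeasure_uniformOn (Set.univ : Set (Fin n))
  have := fun f : Fin N → Fin n => isFiniteMeasure_map_pi_blockLaw hv G f
  rw [reduction, bind_real_apply _ _ (measurableSet_singleton H)]
  refine Finset.sum_congr rfl fun f _ => ?_
  rw [map_pi_blockLaw_real_singleton hv, pi_real_singleton]
  congr 1
  simp [uniformOn_real_singleton]

/-! ### Averaging over the input graph -/

/-- The mass function of the number of edges in the block `d` when the input graph is a random graph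
turned into a clique on `C`. -/
noncomputable def avgMass (ℓ : ℕ) (γ p q : I) (C : Set (Fin n)) (f : Fin N → Fin n)
    (d : Sym2 (Fin n)) (m : ℕ) : ℝ :=
  open Classical in
  if ¬ d.IsDiag ∧ d ∈ pairsIn C ∧
      max (numChildren f d.inf) (numChildren f d.sup) ≤ 2 * ℓ then
    massP γ p q (numChildren f d.inf) (numChildren f d.sup) m
  else binomMass (blockOf f d).ncard q m

lemma inf_eq_sup_iff_isDiag (d : Sym2 (Fin n)) : d.inf = d.sup ↔ d.IsDiag := by
  induction d with | _ a b
  simp [Sym2.inf_mk, Sym2.sup_mk]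

lemma blockOf_eq (f : Fin N → Fin n) (d : Sym2 (Fin n)) : blockOf f d = block f d.inf d.sup := by
  rw [block_eq_blockOf]
  congr 1
  exact (Sym2.sortEquiv.symm_apply_apply d).symm

lemma ncard_blockOf_of_isDiag (f : Fin N → Fin n) {d : Sym2 (Fin n)} (h : d.IsDiag) :
    (blockOf f d).ncard = (numChildren f d.inf).choose 2 := by
  rw [blockOf_eq, ← (inf_eq_sup_iff_isDiag d).2 h, ncard_block_self]

lemma ncard_blockOf_of_not_isDiag (f : Fin N → Fin n) {d : Sym2 (Fin n)} (h : ¬ d.IsDiag) :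
    (blockOf f d).ncard = numChildren f d.inf * numChildren f d.sup := by
  rw [blockOf_eq, ncard_block_of_ne f (mt (inf_eq_sup_iff_isDiag d).1 h)]

lemma blockMass_congr {α : Type*} {w w' : ℕ → ℝ} (h : ∀ m, w m = w' m) (B F : Set α) :
    blockMass w B F = blockMass w' B F := by rw [funext h]

lemma blockMass_mix {α : Type*} (a b : ℝ) (w w' : ℕ → ℝ) (B F : Set α) :
    a * blockMass w B F + b * blockMass w' B F = blockMass (fun m => a * w m + b * w' m) B F := by
  unfold blockMass
  split_ifs <;> ring

/-- Each off-diagonal block depends on its own independent input pair, so the average of the product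
is the product of averages: γP' + (1-γ)Q' = Q off the clique and P' inside it, for blocks that are
not oversized. Diagonal and oversized blocks do not see the input. -/
lemma sum_edgeLaw_mul_prod (hγ : (γ : ℝ) ≤ 1 / 2) (C : Set (Fin n)) (f : Fin N → Fin n)
    (X : Sym2 (Fin n) → Set (Sym2 (Fin N))) :
    ∑ G : SimpleGraph (Fin n), edgeLaw (fun _ => (γ : ℝ)) G *
      ∏ d : Sym2 (Fin n), blockMass (countMass ℓ γ p q f d.inf d.sup
        (d ∈ (G ⊔ SimpleGraph.fromEdgeSet (pairsIn C)).edgeSet)) (blockOf f d) (X d) =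
      ∏ d : Sym2 (Fin n), blockMass (avgMass ℓ γ p q C f d) (blockOf f d) (X d) := by
  classical
  have hdiag : ∀ (d : Sym2 (Fin n)) (b : Prop), d.IsDiag → ∀ m,
      countMass ℓ γ p q f d.inf d.sup b m = avgMass ℓ γ p q C f d m := by
    intro d b hd m
    rw [countMass, avgMass, if_pos ((inf_eq_sup_iff_isDiag d).2 hd), if_neg (by simp [hd]),
      ncard_blockOf_of_isDiag f hd]
  have hmix : ∀ d : Sym2 (Fin n), ¬ d.IsDiag → ∀ m,
      (γ : ℝ) * countMass ℓ γ p q f d.inf d.sup (True ∨ d ∈ pairsIn C) m +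
        (1 - γ) * countMass ℓ γ p q f d.inf d.sup (False ∨ d ∈ pairsIn C) m =
      avgMass ℓ γ p q C f d m := by
    intro d hd m
    have hne := mt (inf_eq_sup_iff_isDiag d).1 hd
    simp only [countMass, avgMass, if_neg hne, ncard_blockOf_of_not_isDiag f hd]
    by_cases h1 : 2 * ℓ < max (numChildren f d.inf) (numChildren f d.sup)
    · rw [if_pos h1, if_pos h1, if_neg (by omega)]
      ring
    · rw [if_neg h1, if_neg h1]
      by_cases h2 : d ∈ pairsIn C
      · simp only [h2, or_true, if_true]
        rw [if_pos ⟨hd, trivial, by omega⟩]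
        ring
      · simp only [h2, or_false, if_true, if_false, false_and, and_false]
        exact mix_massP_massQ hγ p q _ _ m
  have hsplit : ∀ g : Sym2 (Fin n) → ℝ, ∏ d, g d =
      (∏ d ∈ potentialEdges (Fin n), g d) *
        ∏ d ∈ Finset.univ.filter (fun d : Sym2 (Fin n) => ¬ ¬ d.IsDiag), g d := by
    intro g
    rw [potentialEdges, ← Finset.prod_filter_mul_prod_filter_not Finset.univ
      (fun d : Sym2 (Fin n) => ¬ d.IsDiag)]
    congr 1
    refine Finset.prod_congr ?_ fun _ _ => rfl
    ext; simp
  have hG := sum_graph_prod (V := Fin n) (fun d b => (if b then (γ : ℝ) else 1 - γ) *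
    blockMass (countMass ℓ γ p q f d.inf d.sup (b ∨ d ∈ pairsIn C)) (blockOf f d) (X d))
  simp only [if_true, if_false, blockMass_mix] at hG
  rw [hsplit fun d => blockMass (avgMass ℓ γ p q C f d) (blockOf f d) (X d)]
  have hR : ∏ d ∈ potentialEdges (Fin n),
      blockMass (avgMass ℓ γ p q C f d) (blockOf f d) (X d) =
      ∏ d ∈ potentialEdges (Fin n), blockMass (fun m =>
        (γ : ℝ) * countMass ℓ γ p q f d.inf d.sup (True ∨ d ∈ pairsIn C) m +
        (1 - γ) * countMass ℓ γ p q f d.inf d.sup (False ∨ d ∈ pairsIn C) m)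
        (blockOf f d) (X d) := by
    refine Finset.prod_congr rfl fun d hd => ?_
    exact blockMass_congr (fun m => (hmix d (mem_potentialEdges.1 hd) m).symm) _ _
  rw [hR, ← hG, Finset.sum_mul]
  refine Finset.sum_congr rfl fun G _ => ?_
  rw [hsplit, ← mul_assoc, edgeLaw, ← Finset.prod_mul_distrib]
  congr 1
  · refine Finset.prod_congr rfl fun d hd => ?_
    have hd' := mem_potentialEdges.1 hd
    congr 1
    · split_ifs <;> rfl
    · have : (d ∈ (G ⊔ SimpleGraph.fromEdgeSet (pairsIn C)).edgeSet) =
          (d ∈ G.edgeSet ∨ d ∈ pairsIn C) := by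
        simp [SimpleGraph.edgeSet_sup, hd']
      rw [this]
  · refine Finset.prod_congr rfl fun d hd => ?_
    have hd' : d.IsDiag := by simpa using hd
    exact blockMass_congr (fun m => hdiag d _ hd' m) _ _

/-- The law of the output graph given the parent map `f`, when the input graph is a random graph
turned into a clique on `C`. -/
noncomputable def outputMass (ℓ : ℕ) (γ p q : I) (C : Set (Fin n)) (f : Fin N → Fin n)
    (H : SimpleGraph (Fin N)) : ℝ :=
  ∏ d : Sym2 (Fin n), blockMass (avgMass ℓ γ p q C f d) (blockOf f d) (H.edgeSet ∩ blockOf f d)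

lemma map_sup_bind_reduction_real_singleton (hv : ValidMasses ℓ γ p q) (hγ : (γ : ℝ) ≤ 1 / 2)
    (C : Set (Fin n)) (H : SimpleGraph (Fin N)) :
    (((SimpleGraph.binomialRandom (Fin n) γ).map
      fun G => G ⊔ SimpleGraph.fromEdgeSet (pairsIn C)).bind (reduction ℓ γ p q N)).real {H} =
      ∑ f : Fin N → Fin n, (1 / (n : ℝ)) ^ N * outputMass ℓ γ p q C f H := by
  have := fun G : SimpleGraph (Fin n) => isFiniteMeasure_reduction (N := N) hv G
  rw [map_bind_real_apply _ _ _ (measurableSet_singleton H)]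
  simp_rw [reduction_real_singleton hv, binomialRandom_real_singleton, Finset.mul_sum]
  rw [Finset.sum_comm]
  refine Finset.sum_congr rfl fun f _ => ?_
  rw [outputMass, ← sum_edgeLaw_mul_prod hγ C f fun d => H.edgeSet ∩ blockOf f d, Finset.mul_sum]
  refine Finset.sum_congr rfl fun G _ => ?_
  ring

/-- The pairs are grouped by the parents of their ends; a binomial law in each block is then a law
with independent edges on the whole graph. -/
lemma prod_blockMass_binomMass (f : Fin N → Fin n) (r : Sym2 (Fin n) → I)
    (H : SimpleGraph (Fin N)) :
    ∏ d, blockMass (binomMass (blockOf f d).ncard (r d)) (blockOf f d) (H.edgeSet ∩ blockOf f d) =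
      edgeLaw (fun e => (r (e.map f) : ℝ)) H := by
  classical
  rw [edgeLaw, ← Finset.prod_fiberwise _ (fun e : Sym2 (Fin N) => e.map f)]
  refine Finset.prod_congr rfl fun d _ => ?_
  rw [blockMass_binomMass]
  refine Finset.prod_congr ?_ fun e he => ?_
  · ext e
    simp only [Set.mem_toFinset, Finset.mem_filter, mem_potentialEdges]
    rfl
  · have : e.map f = d := (Finset.mem_filter.1 he).2
    rw [this]

lemma avgMass_empty (f : Fin N → Fin n) (d : Sym2 (Fin n)) (m : ℕ) :
    avgMass ℓ γ p q ∅ f d m = binomMass (blockOf f d).ncard q m := by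
  rw [avgMass, if_neg]
  rintro ⟨-, h, -⟩
  exact h _ (Sym2.out_fst_mem d)

lemma sum_const_parents (hn : n ≠ 0) : ∑ _f : Fin N → Fin n, (1 / (n : ℝ)) ^ N = 1 := by
  have : (n : ℝ) ≠ 0 := by exact_mod_cast hn
  simp [this]

lemma binomialRandom_bind_reduction (hv : ValidMasses ℓ γ p q) (hγ : (γ : ℝ) ≤ 1 / 2)
    (hn : n ≠ 0) :
    (SimpleGraph.binomialRandom (Fin n) γ).bind (reduction ℓ γ p q N) =
      SimpleGraph.binomialRandom (Fin N) q := by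
  have := fun G : SimpleGraph (Fin n) => isFiniteMeasure_reduction (N := N) hv G
  have hfin := isFiniteMeasure_bind_fintype (SimpleGraph.binomialRandom (Fin n) γ)
    (reduction ℓ γ p q N)
  refine Measure.ext_of_measureReal_singleton fun H => ?_
  -- The unplanted model is treated as the planted one with C = ∅.
  have hmap : ((SimpleGraph.binomialRandom (Fin n) γ).map
      fun G => G ⊔ SimpleGraph.fromEdgeSet (pairsIn (∅ : Set (Fin n)))) =
      SimpleGraph.binomialRandom (Fin n) γ := by
    have : pairsIn (∅ : Set (Fin n)) = ∅ := by
      ext d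
      simpa [pairsIn] using ⟨_, Sym2.out_fst_mem d⟩
    simp [this]
  have h := map_sup_bind_reduction_real_singleton (n := n) (N := N) hv hγ ∅ H
  rw [hmap] at h
  rw [h, binomialRandom_real_singleton]
  have h2 : ∀ f : Fin N → Fin n, outputMass ℓ γ p q ∅ f H = edgeLaw (fun _ => (q : ℝ)) H := by
    intro f
    rw [← prod_blockMass_binomMass f (fun _ => q), outputMass]
    exact Finset.prod_congr rfl fun d _ => blockMass_congr (avgMass_empty f d) _ _
  simp_rw [h2]
  rw [← Finset.sum_mul, sum_const_parents hn, one_mul]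

open Classical in
lemma plantedClique_bind_reduction_real_singleton {k : ℕ} (hv : ValidMasses ℓ γ p q)
    (hγ : (γ : ℝ) ≤ 1 / 2) (H : SimpleGraph (Fin N)) :
    ((plantedClique n k γ).bind (reduction ℓ γ p q N)).real {H} =
      ∑ C : Set (Fin n), (uniformOn {C : Set (Fin n) | C.ncard = k}).real {C} *
        ∑ f : Fin N → Fin n, (1 / (n : ℝ)) ^ N * outputMass ℓ γ p q C f H := by
  have := fun G : SimpleGraph (Fin n) => isFiniteMeasure_reduction (N := N) hv G
  have := isFiniteMeasure_uniformOn {C : Set (Fin n) | C.ncard = k}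
  have := fun C : Set (Fin n) => isFiniteMeasure_bind_fintype
    ((SimpleGraph.binomialRandom (Fin n) γ).map fun G => G ⊔ SimpleGraph.fromEdgeSet (pairsIn C))
    (reduction ℓ γ p q N)
  rw [plantedClique, Measure.bind_bind (Measurable.of_discrete).aemeasurable
    (Measurable.of_discrete).aemeasurable, bind_real_apply _ _ (measurableSet_singleton H)]
  simp_rw [map_sup_bind_reduction_real_singleton hv hγ]

open Classical in
lemma plantedDense_real_singleton {K : ℕ} (H : SimpleGraph (Fin N)) :
    (plantedDense N K p q).real {H} = ∑ S : Set (Fin N),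
      (setBernoulli (Set.univ : Set (Fin N)) (Set.projIcc (0 : ℝ) 1 zero_le_one (K / N))).real {S} *
        edgeLaw (fun e => if e ∈ pairsIn S then (p : ℝ) else q) H := by
  rw [plantedDense, bind_real_apply _ _ (measurableSet_singleton H)]
  simp_rw [map_prod_setBernoulli_real_singleton]

end

/-! ### Resampling and exponential Markov bounds -/

section Resampling

variable {ι β : Type*} [Fintype ι] [DecidableEq ι]

lemma sum_piFinset_prod (A : ι → Finset β) (g : ι → β → ℝ) :
    ∑ f ∈ Fintype.piFinset A, ∏ i, g i (f i) = ∏ i, ∑ t ∈ A i, g i t :=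
  (Finset.prod_univ_sum A g).symm

/-- Exchanging the coordinate at a with the fresh value t is an involution of the pairs (f, t):
resampling one coordinate preserves the uniform law. -/
lemma sum_update_piFinset (A : ι → Finset β) (a : ι) (Ψ : (ι → β) → ℝ) :
    ∑ f ∈ Fintype.piFinset A, ∑ t ∈ A a, Ψ (Function.update f a t) =
      (A a).card * ∑ f ∈ Fintype.piFinset A, Ψ f := by
  have h1 : ((A a).card : ℝ) * ∑ f ∈ Fintype.piFinset A, Ψ f =
      ∑ x ∈ Fintype.piFinset A ×ˢ A a, Ψ x.1 := by
    rw [Finset.sum_product, Finset.mul_sum]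
    simp
  have hmem : ∀ x ∈ Fintype.piFinset A ×ˢ A a,
      (Function.update x.1 a x.2, x.1 a) ∈ Fintype.piFinset A ×ˢ A a := by
    rintro ⟨f, t⟩ hx
    rw [Finset.mem_product, Fintype.mem_piFinset] at hx
    rw [Finset.mem_product, Fintype.mem_piFinset]
    refine ⟨fun i => ?_, hx.1 a⟩
    by_cases hi : i = a
    · subst hi
      simpa using hx.2
    · simpa [hi] using hx.1 i
  rw [h1, ← Finset.sum_product']
  refine Finset.sum_nbij' (fun x => (Function.update x.1 a x.2, x.1 a))
    (fun x => (Function.update x.1 a x.2, x.1 a)) hmem hmem ?_ ?_ ?_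
  · rintro ⟨f, t⟩ _
    simp
  · rintro ⟨f, t⟩ _
    simp
  · rintro ⟨f, t⟩ _
    rfl

end Resampling

/-- Markov's inequality for the counting measure. -/
lemma card_filter_mul_le {α : Type*} (T : Finset α) (P : α → Prop) [DecidablePred P] (φ : α → ℝ)
    (c : ℝ) (h0 : ∀ x ∈ T, 0 ≤ φ x) (h : ∀ x ∈ T, P x → c ≤ φ x) :
    ((T.filter P).card : ℝ) * c ≤ ∑ x ∈ T, φ x := by
  calc ((T.filter P).card : ℝ) * c = ∑ x ∈ T.filter P, c := by simp
    _ ≤ ∑ x ∈ T.filter P, φ x :=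
        Finset.sum_le_sum fun x hx => h x (Finset.mem_filter.1 hx).1 (Finset.mem_filter.1 hx).2
    _ ≤ _ := Finset.sum_le_sum_of_subset_of_nonneg (Finset.filter_subset _ _) fun x hx _ => h0 x hx

/-- The rates 5/18 here and 7/18 in `exp_le_three_halves` are chosen to give the exponents ℓ/18 and
K/12: 2·5/18 - 1/2 = 1/18 and 1.5·7/18 - 1/2 = 1/12. -/
lemma exp_le_four_thirds : Real.exp (5 / 18) ≤ 4 / 3 := by
  refine le_of_pow_le_pow_left₀ (n := 18) (by norm_num) (by norm_num) ?_
  rw [← Real.exp_nat_mul]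
  have h : ((18 : ℕ) : ℝ) * (5 / 18) = (5 : ℕ) * 1 := by norm_num
  rw [h, Real.exp_nat_mul]
  calc Real.exp 1 ^ 5 ≤ 2.72 ^ 5 :=
        pow_le_pow_left₀ (Real.exp_pos _).le (by linarith [Real.exp_one_lt_d9]) 5
    _ ≤ _ := by norm_num

lemma exp_le_three_halves : Real.exp (7 / 18) ≤ 3 / 2 := by
  refine le_of_pow_le_pow_left₀ (n := 18) (by norm_num) (by norm_num) ?_
  rw [← Real.exp_nat_mul]
  have h : ((18 : ℕ) : ℝ) * (7 / 18) = (7 : ℕ) * 1 := by norm_num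
  rw [h, Real.exp_nat_mul]
  calc Real.exp 1 ^ 7 ≤ 2.72 ^ 7 :=
        pow_le_pow_left₀ (Real.exp_pos _).le (by linarith [Real.exp_one_lt_d9]) 7
    _ ≤ _ := by norm_num

/-! ### Parent maps with a prescribed planted set -/

section Fibers

variable {n N : ℕ}

open Classical in
/-- The parents allowed for the vertex `i` if exactly the vertices in `S` have a parent in `C`. -/
noncomputable def allowedParents (C : Set (Fin n)) (S : Set (Fin N)) (i : Fin N) : Finset (Fin n) :=
  if i ∈ S then C.toFinset else Cᶜ.toFinset

/-- The parent maps under which exactly the vertices in `S` have a parent in `C`. -/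
noncomputable def parentMaps (C : Set (Fin n)) (S : Set (Fin N)) : Finset (Fin N → Fin n) :=
  Fintype.piFinset (allowedParents C S)

lemma mem_parentMaps {C : Set (Fin n)} {S : Set (Fin N)} {f : Fin N → Fin n} :
    f ∈ parentMaps C S ↔ f ⁻¹' C = S := by
  classical
  rw [parentMaps, Fintype.mem_piFinset, Set.ext_iff]
  refine forall_congr' fun i => ?_
  unfold allowedParents
  by_cases h : i ∈ S <;> simp [h]

lemma card_allowedParents_of_mem (C : Set (Fin n)) {S : Set (Fin N)} {i : Fin N} (h : i ∈ S) :
    (allowedParents C S i).card = C.ncard := by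
  classical
  rw [allowedParents, if_pos h, Set.ncard_eq_toFinset_card']

lemma card_parentMaps (C : Set (Fin n)) (S : Set (Fin N)) :
    (parentMaps C S).card = C.ncard ^ S.ncard * (n - C.ncard) ^ (Sᶜ).ncard := by
  classical
  have h : ∀ i, (allowedParents C S i).card = if i ∈ S then C.ncard else n - C.ncard := by
    intro i
    unfold allowedParents
    split_ifs
    · rw [Set.ncard_eq_toFinset_card']
    · rw [← Set.ncard_eq_toFinset_card', Set.ncard_compl]
      simp
  rw [parentMaps, Fintype.card_piFinset]
  simp_rw [h]
  rw [Finset.prod_ite, Finset.prod_const, Finset.prod_const, ← Set.ncard_coe_finset,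
    ← Set.ncard_coe_finset]
  congr 3 <;> · ext; simp

/-- Under uniform parents each vertex lands in C independently with probability k/n = K/N, so the
planted set of the target model is reproduced exactly and can be coupled at no cost. -/
lemma setBernoulli_real_eq_card_parentMaps {ℓ k K : ℕ} {C : Set (Fin n)} (hC : C.ncard = k)
    (hℓ : 1 ≤ ℓ) (hn : n ≠ 0) (hN : N = ℓ * n) (hK : K = k * ℓ) (S : Set (Fin N)) :
    (setBernoulli (Set.univ : Set (Fin N))
      (Set.projIcc (0 : ℝ) 1 zero_le_one (K / N))).real {S} =
      (1 / (n : ℝ)) ^ N * (parentMaps C S).card := by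
  have hkn : k ≤ n := by
    rw [← hC]
    simpa using Set.ncard_le_card C
  have hn' : (0 : ℝ) < n := by exact_mod_cast Nat.pos_of_ne_zero hn
  have hℓ' : (0 : ℝ) < ℓ := by exact_mod_cast hℓ
  have hkn' : (k : ℝ) ≤ n := by exact_mod_cast hkn
  have hr : (K : ℝ) / N = k / n := by
    rw [hN, hK]
    push_cast
    field_simp
  have hmem : (K : ℝ) / N ∈ Set.Icc (0 : ℝ) 1 := by
    rw [hr]
    exact ⟨by positivity, by rw [div_le_one hn']; exact hkn'⟩
  rw [setBernoulli_real_singleton _ (Set.subset_univ S) (Set.toFinite _),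
    Set.projIcc_of_mem zero_le_one hmem, ← Set.compl_eq_univ_sdiff, card_parentMaps, hC]
  simp only [hr]
  have hNS : (1 / (n : ℝ)) ^ N = (1 / (n : ℝ)) ^ S.ncard * (1 / (n : ℝ)) ^ (Sᶜ).ncard := by
    rw [← pow_add, Set.ncard_add_ncard_compl]
    simp
  rw [hNS]
  push_cast [Nat.cast_sub hkn]
  have : 1 - (k : ℝ) / n = 1 / n * (n - k) := by field_simp
  rw [this, mul_pow, div_eq_mul_one_div, mul_comm (k : ℝ), mul_pow]
  ring

lemma prod_ite_eq_pow_numChildren (z : ℝ) (f : Fin N → Fin n) (s : Fin n) :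
    ∏ i, (if f i = s then z else 1) = z ^ numChildren f s := by
  classical
  rw [Finset.prod_ite, Finset.prod_const, Finset.prod_const_one, mul_one, numChildren,
    ← Set.ncard_coe_finset]
  congr 2
  ext; simp

/-- Chernoff bound for the number of children of a fixed clique vertex. -/
lemma card_filter_numChildren_le {ℓ k : ℕ} {C : Set (Fin n)} (hC : C.ncard = k) (hk : 1 ≤ k)
    {S : Set (Fin N)} (hS : (S.ncard : ℝ) ≤ 1.5 * (k * ℓ)) {s : Fin n} (hs : s ∈ C) :
    (((parentMaps C S).filter fun f => 2 * ℓ < numChildren f s).card : ℝ) ≤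
      (parentMaps C S).card * Real.exp (-(ℓ : ℝ) / 18) := by
  classical
  have hk' : (0 : ℝ) < k := by exact_mod_cast hk
  -- Tilt by 4/3: the threshold 2ℓ yields exp(5ℓ/9). The mean of the weight is (1 + 1/(3k))^|S| ≤
  -- exp(ℓ/2), since vertices of S have uniform parents in C and the others never have parent s.
  have h1 := card_filter_mul_le (parentMaps C S) (fun f => 2 * ℓ < numChildren f s)
    (fun f => (4 / 3 : ℝ) ^ numChildren f s) (Real.exp (5 * ℓ / 9)) (fun f _ => by positivity)
    (fun f _ hf => by
      calc Real.exp (5 * ℓ / 9) = Real.exp (5 / 18) ^ (2 * ℓ) := by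
            rw [← Real.exp_nat_mul]
            push_cast
            ring_nf
        _ ≤ (4 / 3 : ℝ) ^ (2 * ℓ) :=
            pow_le_pow_left₀ (Real.exp_pos _).le exp_le_four_thirds _
        _ ≤ _ := pow_le_pow_right₀ (by norm_num) hf.le)
  have h2 : ∑ f ∈ parentMaps C S, (4 / 3 : ℝ) ^ numChildren f s =
      (parentMaps C S).card * (1 + 1 / (3 * k)) ^ S.ncard := by
    simp_rw [← prod_ite_eq_pow_numChildren]
    rw [parentMaps, sum_piFinset_prod _ fun _ t => if t = s then (4 / 3 : ℝ) else 1]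
    have h3 : ∀ i, ∑ t ∈ allowedParents C S i, (if t = s then (4 / 3 : ℝ) else 1) =
        (allowedParents C S i).card * (if i ∈ S then (1 + 1 / (3 * k) : ℝ) else 1) := by
      intro i
      have h4 : ∑ t ∈ allowedParents C S i, (if t = s then (4 / 3 : ℝ) else 1) =
          (allowedParents C S i).card + if s ∈ allowedParents C S i then (1 / 3 : ℝ) else 0 := by
        have h5 : ∀ t : Fin n, (if t = s then (4 / 3 : ℝ) else 1) =
            1 + if t = s then (1 / 3 : ℝ) else 0 := by
          intro t
          split_ifs <;> norm_num
        simp_rw [h5]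
        rw [Finset.sum_add_distrib, Finset.sum_ite_eq']
        simp
      rw [h4]
      by_cases hi : i ∈ S
      · have : s ∈ allowedParents C S i := by simpa [allowedParents, hi] using hs
        rw [if_pos this, if_pos hi, card_allowedParents_of_mem C hi, hC]
        field_simp
      · have : s ∉ allowedParents C S i := by simpa [allowedParents, hi] using hs
        rw [if_neg this, if_neg hi]
        ring
    simp_rw [h3]
    rw [Finset.prod_mul_distrib, Fintype.card_piFinset]
    push_cast
    congr 1
    rw [Finset.prod_ite, Finset.prod_const, Finset.prod_const_one, mul_one,
      ← Set.ncard_coe_finset]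
    congr 2
    ext; simp
  have h3 : (1 + 1 / (3 * k) : ℝ) ^ S.ncard ≤ Real.exp (ℓ / 2) := by
    calc (1 + 1 / (3 * k) : ℝ) ^ S.ncard ≤ Real.exp (1 / (3 * k)) ^ S.ncard := by
          gcongr
          linarith [Real.add_one_le_exp (1 / (3 * (k : ℝ)))]
      _ = Real.exp (S.ncard * (1 / (3 * k))) := by rw [Real.exp_nat_mul]
      _ ≤ _ := by
          apply Real.exp_le_exp.2
          rw [mul_one_div, div_le_iff₀ (by positivity)]
          nlinarith
  rw [h2] at h1
  have h4 : Real.exp (5 * ℓ / 9) * Real.exp (-(ℓ : ℝ) / 18) = Real.exp (ℓ / 2) := by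
    rw [← Real.exp_add]
    ring_nf
  have h5 : 0 < Real.exp (5 * (ℓ : ℝ) / 9) := Real.exp_pos _
  refine le_of_mul_le_mul_right ?_ h5
  calc _ ≤ _ := h1
    _ ≤ (parentMaps C S).card * Real.exp (ℓ / 2) := by gcongr
    _ = _ := by rw [← h4]; ring

/-- Chernoff bound for the number of vertices with a parent in `C`. -/
lemma card_filter_ncard_preimage_le {ℓ k : ℕ} {C : Set (Fin n)} (hC : C.ncard = k) (hn : n ≠ 0)
    (hN : N = ℓ * n) :
    (1 / (n : ℝ)) ^ N * ((Finset.univ.filter fun f : Fin N → Fin n =>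
      1.5 * ((k : ℝ) * ℓ) < (f ⁻¹' C).ncard).card : ℝ) ≤ Real.exp (-((k : ℝ) * ℓ) / 12) := by
  classical
  have hn' : (0 : ℝ) < n := by exact_mod_cast Nat.pos_of_ne_zero hn
  -- Tilt by 3/2: the threshold 1.5kℓ yields exp(7kℓ/12), against a mean of (1 + k/(2n))^N ≤
  -- exp(kℓ/2).
  have h1 := card_filter_mul_le (Finset.univ : Finset (Fin N → Fin n))
    (fun f => 1.5 * ((k : ℝ) * ℓ) < (f ⁻¹' C).ncard)
    (fun f => (3 / 2 : ℝ) ^ (f ⁻¹' C).ncard) (Real.exp (7 * (k * ℓ) / 12))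
    (fun f _ => by positivity)
    (fun f _ hf => by
      calc Real.exp (7 * (k * ℓ) / 12) ≤ Real.exp ((f ⁻¹' C).ncard * (7 / 18)) := by
            apply Real.exp_le_exp.2
            linarith
        _ = Real.exp (7 / 18) ^ (f ⁻¹' C).ncard := by rw [Real.exp_nat_mul]
        _ ≤ _ := pow_le_pow_left₀ (Real.exp_pos _).le exp_le_three_halves _)
  have h2 : ∑ f : Fin N → Fin n, (3 / 2 : ℝ) ^ (f ⁻¹' C).ncard = (n + k / 2) ^ N := by
    have h3 : ∀ f : Fin N → Fin n, (3 / 2 : ℝ) ^ (f ⁻¹' C).ncard =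
        ∏ i, (if f i ∈ C then (3 / 2 : ℝ) else 1) := by
      intro f
      rw [Finset.prod_ite, Finset.prod_const, Finset.prod_const_one, mul_one,
        ← Set.ncard_coe_finset]
      congr 2
      ext; simp
    simp_rw [h3]
    have h4 := sum_piFinset_prod (fun _ : Fin N => (Finset.univ : Finset (Fin n)))
      (fun _ t => if t ∈ C then (3 / 2 : ℝ) else 1)
    rw [Fintype.piFinset_univ] at h4
    rw [h4]
    have h5 : ∑ t : Fin n, (if t ∈ C then (3 / 2 : ℝ) else 1) = n + k / 2 := by
      have h6 : ∀ t : Fin n, (if t ∈ C then (3 / 2 : ℝ) else 1) =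
          1 + if t ∈ C then (1 / 2 : ℝ) else 0 := by
        intro t
        split_ifs <;> norm_num
      simp_rw [h6]
      rw [Finset.sum_add_distrib, ← Finset.sum_filter, Finset.sum_const, Finset.sum_const,
        ← Set.ncard_coe_finset (Finset.univ.filter _)]
      have : ((Finset.univ.filter fun t => t ∈ C : Finset (Fin n)) : Set (Fin n)) = C := by
        ext; simp
      rw [this, hC]
      simp
      ring
    rw [h5]
    simp
  rw [h2] at h1
  have h3 : (1 / (n : ℝ)) ^ N * (n + k / 2) ^ N ≤ Real.exp (k * ℓ / 2) := by
    rw [← mul_pow]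
    have : 1 / (n : ℝ) * (n + k / 2) = k / (2 * n) + 1 := by field_simp; ring
    rw [this]
    calc (k / (2 * n) + 1 : ℝ) ^ N ≤ Real.exp (k / (2 * n)) ^ N := by
          gcongr
          exact Real.add_one_le_exp _
      _ = Real.exp (N * (k / (2 * n))) := by rw [Real.exp_nat_mul]
      _ = _ := by
          rw [hN]
          congr 1
          push_cast
          field_simp
  have h4 : Real.exp (7 * (k * ℓ) / 12) * Real.exp (-((k : ℝ) * ℓ) / 12) =
      Real.exp (k * ℓ / 2) := by
    rw [← Real.exp_add]
    ring_nf
  have h5 : 0 < Real.exp (7 * ((k : ℝ) * ℓ) / 12) := Real.exp_pos _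
  refine le_of_mul_le_mul_right ?_ h5
  calc _ = (1 / (n : ℝ)) ^ N * (((Finset.univ.filter fun f : Fin N → Fin n =>
      1.5 * ((k : ℝ) * ℓ) < (f ⁻¹' C).ncard).card : ℝ) * Real.exp (7 * (k * ℓ) / 12)) := by ring
    _ ≤ (1 / (n : ℝ)) ^ N * (n + k / 2) ^ N := by gcongr
    _ ≤ _ := h3
    _ = _ := by rw [← h4]; ring

/-- All vertices of `C` have at most `2 * ℓ` children. -/
def FewChildren (ℓ : ℕ) (C : Set (Fin n)) (f : Fin N → Fin n) : Prop :=
  ∀ s ∈ C, numChildren f s ≤ 2 * ℓ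

-- Union bound over the k vertices of C.
open Classical in
lemma card_filter_not_fewChildren_le {ℓ k : ℕ} {C : Set (Fin n)} (hC : C.ncard = k) (hk : 1 ≤ k)
    {S : Set (Fin N)} (hS : (S.ncard : ℝ) ≤ 1.5 * (k * ℓ)) :
    (((parentMaps C S).filter fun f => ¬ FewChildren ℓ C f).card : ℝ) ≤
      (parentMaps C S).card * (k * Real.exp (-(ℓ : ℝ) / 18)) := by
  have h1 : (parentMaps C S).filter (fun f => ¬ FewChildren ℓ C f) ⊆
      C.toFinset.biUnion fun s => (parentMaps C S).filter fun f => 2 * ℓ < numChildren f s := by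
    intro f hf
    rw [Finset.mem_filter] at hf
    obtain ⟨hf1, hf2⟩ := hf
    unfold FewChildren at hf2
    push Not at hf2
    obtain ⟨s, hs, hs2⟩ := hf2
    rw [Finset.mem_biUnion]
    exact ⟨s, by simpa using hs, Finset.mem_filter.2 ⟨hf1, hs2⟩⟩
  have h2 := (Finset.card_le_card h1).trans Finset.card_biUnion_le
  calc _ ≤ ((∑ s ∈ C.toFinset,
        ((parentMaps C S).filter fun f => 2 * ℓ < numChildren f s).card : ℕ) : ℝ) := by
        exact_mod_cast h2
    _ ≤ ∑ s ∈ C.toFinset, (parentMaps C S).card * Real.exp (-(ℓ : ℝ) / 18) := by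
        push_cast
        exact Finset.sum_le_sum fun s hs => card_filter_numChildren_le hC hk hS (by simpa using hs)
    _ = _ := by
        rw [Finset.sum_const, ← Set.ncard_eq_toFinset_card', hC, nsmul_eq_mul]
        ring

/-! ### Collisions of two parent maps -/

open Classical in
/-- The pairs inside `T` whose members have the same parent both under `f` and under `f'`. -/
noncomputable def collisions (f f' : Fin N → Fin n) (T : Finset (Fin N)) : Finset (Sym2 (Fin N)) :=
  (potentialEdges (Fin N)).filter fun e =>
    e ∈ pairsIn (T : Set (Fin N)) ∧ (e.map f).IsDiag ∧ (e.map f').IsDiag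

/-- A new collision must contain a, and is determined by its other end. -/
lemma card_collisions_insert_le [DecidableEq (Fin N)] (f f' : Fin N → Fin n) (a : Fin N)
    (T : Finset (Fin N)) :
    (collisions f f' (insert a T)).card ≤ (collisions f f' T).card +
      (T.filter fun j => f j = f a ∧ f' j = f' a).card := by
  classical
  have h : collisions f f' (insert a T) ⊆ collisions f f' T ∪
      (T.filter fun j => f j = f a ∧ f' j = f' a).image fun j => s(a, j) := by
    intro e
    induction e with | _ i j
    simp only [collisions, pairsIn, Finset.mem_filter, Finset.mem_union, Finset.mem_image,
      mem_potentialEdges, Sym2.map_mk, Sym2.mk_isDiag_iff, Set.mem_ofPred_eq, Sym2.mem_iff,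
      Finset.coe_insert, Set.mem_insert_iff, Finset.mem_coe, forall_eq_or_imp, forall_eq,
      Sym2.eq_iff]
    rintro ⟨hij, ⟨hi, hj⟩, h1, h2⟩
    rcases hi with rfl | hi
    · rcases hj with rfl | hj
      · exact absurd rfl hij
      · exact Or.inr ⟨j, ⟨hj, h1.symm, h2.symm⟩, Or.inl ⟨rfl, rfl⟩⟩
    · rcases hj with rfl | hj
      · exact Or.inr ⟨i, ⟨hi, h1, h2⟩, Or.inr ⟨rfl, rfl⟩⟩
      · exact Or.inl ⟨hij, ⟨hi, hj⟩, h1, h2⟩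
  calc _ ≤ _ := Finset.card_le_card h
    _ ≤ _ := Finset.card_union_le _ _
    _ ≤ _ := by
        gcongr
        exact Finset.card_image_le

lemma collisions_update [DecidableEq (Fin N)] (f f' : Fin N → Fin n) {a : Fin N}
    {T : Finset (Fin N)} (ha : a ∉ T) (t : Fin n) :
    collisions f (Function.update f' a t) T = collisions f f' T := by
  classical
  ext e
  induction e with | _ i j
  simp only [collisions, pairsIn, Finset.mem_filter, mem_potentialEdges, Sym2.map_mk,
    Sym2.mk_isDiag_iff, Set.mem_ofPred_eq, Sym2.mem_iff, Finset.mem_coe, forall_eq_or_imp,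
    forall_eq]
  refine and_congr_right fun _ => and_congr_right fun h => ?_
  have hi : i ≠ a := fun h' => ha (h' ▸ h.1)
  have hj : j ≠ a := fun h' => ha (h' ▸ h.2)
  rw [Function.update_of_ne hi, Function.update_of_ne hj]

/-- This is e^z ≤ 1 + 2z on [0, 1]. Linearizing in D is what lets the sum over the resampled parent
see only the total number of siblings. -/
lemma one_add_pow_le {y : ℝ} (hy : 0 ≤ y) {D M : ℕ} (hD : D ≤ M) (hM : y * M ≤ 1) :
    (1 + y) ^ D ≤ 1 + 2 * y * D := by
  have hDM : (D : ℝ) ≤ M := by exact_mod_cast hD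
  have h1 : y * D ≤ 1 := (mul_le_mul_of_nonneg_left hDM hy).trans hM
  have h0 : 0 ≤ y * D := by positivity
  have h2 := Real.abs_exp_sub_one_sub_id_le (x := y * D) (by rw [abs_of_nonneg h0]; exact h1)
  have h3 := (abs_le.1 h2).2
  calc (1 + y) ^ D ≤ Real.exp y ^ D := by
        gcongr
        linarith [Real.add_one_le_exp y]
    _ = Real.exp (y * D) := by rw [← Real.exp_nat_mul, mul_comm]
    _ ≤ _ := by nlinarith

/-- The generating function of the number of collisions, by adding one vertex at a time. -/
lemma sum_pow_card_collisions_le {ℓ k : ℕ} {C : Set (Fin n)} (hC : C.ncard = k) (hk : 1 ≤ k)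
    {S : Set (Fin N)} {f : Fin N → Fin n} (hf : f ∈ parentMaps C S) (hE : FewChildren ℓ C f)
    {y : ℝ} (hy : 0 ≤ y) (hyℓ : y * (2 * ℓ : ℕ) ≤ 1) (T : Finset (Fin N)) (hT : (T : Set _) ⊆ S) :
    ∑ f' ∈ parentMaps C S, (1 + y) ^ (collisions f f' T).card ≤
      (parentMaps C S).card * (1 + 4 * y * ℓ / k) ^ T.card := by
  classical
  have hk' : (0 : ℝ) < k := by exact_mod_cast hk
  induction T using Finset.induction_on with
  | empty =>
    have : ∀ f', collisions f f' (∅ : Finset (Fin N)) = ∅ := by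
      intro f'
      ext e
      induction e with | _ i j
      simp only [collisions, pairsIn, Finset.mem_filter, Finset.coe_empty, Finset.notMem_empty,
        iff_false]
      exact fun h => h.2.1 i (Sym2.mem_mk_left i j)
    simp [this]
  | insert a T ha ih =>
    have haS : a ∈ S := hT (by simp)
    have hTS : (T : Set (Fin N)) ⊆ S := fun x hx => hT (by simp at hx ⊢; exact Or.inr hx)
    have ih := ih hTS
    rw [Finset.card_insert_of_notMem ha, pow_succ, ← mul_assoc]
    have hfa : f a ∈ C := by
      have := mem_parentMaps.1 hf
      rw [← this] at haS
      exact haS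
    have hA : (allowedParents C S a).card = k := by rw [card_allowedParents_of_mem C haS, hC]
    have h1 : ∑ f' ∈ parentMaps C S, (1 + y) ^ (collisions f f' (insert a T)).card ≤
        ∑ f' ∈ parentMaps C S, (1 + y) ^ ((collisions f f' T).card +
          (T.filter fun j => f j = f a ∧ f' j = f' a).card) :=
      Finset.sum_le_sum fun f' _ =>
        pow_le_pow_right₀ (by linarith) (card_collisions_insert_le f f' a T)
    -- The parent of a under f' is resampled uniformly in C. The collisions inside T do not depend
    -- on it, so only the new collisions have to be averaged.
    have h2 := sum_update_piFinset (allowedParents C S) a fun f' =>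
      (1 + y) ^ ((collisions f f' T).card +
          (T.filter fun j => f j = f a ∧ f' j = f' a).card)
    have h3 : ∀ f' ∈ parentMaps C S, ∑ t ∈ allowedParents C S a,
        (1 + y) ^ ((collisions f (Function.update f' a t) T).card +
          (T.filter fun j => f j = f a ∧
            Function.update f' a t j = Function.update f' a t a).card) ≤
        (1 + y) ^ (collisions f f' T).card * (k + 4 * y * ℓ) := by
      intro f' _
      have h4 : ∀ t, (T.filter fun j => f j = f a ∧
          Function.update f' a t j = Function.update f' a t a) =
          T.filter fun j => f j = f a ∧ f' j = t := by
        intro t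
        refine Finset.filter_congr fun j hj => ?_
        have : j ≠ a := fun h => ha (h ▸ hj)
        rw [Function.update_of_ne this, Function.update_self]
      -- Only f needs few children: new collisions come from the at most 2ℓ siblings of a under f,
      -- whatever f' is.
      have hsame : (T.filter fun j => f j = f a).card ≤ 2 * ℓ := by
        refine le_trans ?_ (hE _ hfa)
        rw [numChildren, ← Set.ncard_coe_finset]
        refine Set.ncard_le_ncard ?_
        intro j hj
        have := (Finset.mem_filter.1 (Finset.mem_coe.1 hj)).2
        exact this
      have h5 : ∀ t, (1 + y) ^ (T.filter fun j => f j = f a ∧ f' j = t).card ≤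
          1 + 2 * y * (T.filter fun j => f j = f a ∧ f' j = t).card := by
        intro t
        refine one_add_pow_le hy (M := 2 * ℓ) (le_trans (Finset.card_le_card ?_) hsame) hyℓ
        exact Finset.monotone_filter_right _ fun j _ hj => hj.1
      -- The siblings of a under f are split according to their parent under f', so the numbers of
      -- new collisions over all t add up to at most 2ℓ.
      have h6 : ∑ t ∈ allowedParents C S a, ((T.filter fun j => f j = f a ∧ f' j = t).card : ℝ) ≤
          2 * ℓ := by
        have h7 : ∑ t, (T.filter fun j => f j = f a ∧ f' j = t).card =
            (T.filter fun j => f j = f a).card := by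
          rw [Finset.card_eq_sum_card_fiberwise (f := f') (t := Finset.univ) (by simp)]
          refine Finset.sum_congr rfl fun t _ => ?_
          rw [Finset.filter_filter]
        have h8 : ∑ t ∈ allowedParents C S a, (T.filter fun j => f j = f a ∧ f' j = t).card ≤
            ∑ t, (T.filter fun j => f j = f a ∧ f' j = t).card :=
          Finset.sum_le_sum_of_subset (Finset.subset_univ _)
        rw [h7] at h8
        exact_mod_cast h8.trans hsame
      simp_rw [h4, collisions_update f f' ha, pow_add]
      rw [← Finset.mul_sum]
      gcongr
      calc _ ≤ ∑ t ∈ allowedParents C S a,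
            (1 + 2 * y * ((T.filter fun j => f j = f a ∧ f' j = t).card : ℝ)) :=
            Finset.sum_le_sum fun t _ => h5 t
        _ = k + 2 * y * ∑ t ∈ allowedParents C S a,
            ((T.filter fun j => f j = f a ∧ f' j = t).card : ℝ) := by
            rw [Finset.sum_add_distrib, ← Finset.mul_sum, Finset.sum_const, hA]
            simp
        _ ≤ k + 2 * y * (2 * ℓ) := by gcongr
        _ = _ := by ring
    have h9 := (Finset.sum_le_sum h3)
    rw [parentMaps, h2, hA, ← Finset.sum_mul] at h9
    refine h1.trans ?_
    have h10 : (0 : ℝ) ≤ 1 + 4 * y * ℓ / k := by positivity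
    refine le_trans ?_ (mul_le_mul_of_nonneg_right ih h10)
    refine le_of_mul_le_mul_left ?_ hk'
    refine h9.trans (le_of_eq ?_)
    rw [parentMaps]
    field_simp

end Fibers

/-! ### Second moment and truncation bounds in L¹ -/

section L1

/-- A second moment bound for the `L¹` distance between a truncated mixture of the laws `ν f` and
a law `ρ`. -/
lemma sum_abs_mixture_sub_le {ι Ω : Type*} [Fintype Ω] (T E : Finset ι) (hET : E ⊆ T)
    (ν : ι → Ω → ℝ) (ρ : Ω → ℝ) (hν : ∀ f x, 0 ≤ ν f x) (hν1 : ∀ f, ∑ x, ν f x = 1)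
    (hρ : ∀ x, 0 < ρ x) (hρ1 : ∑ x, ρ x = 1) {ε X : ℝ} (hε : 0 ≤ ε) (hX : 1 ≤ X)
    (hE : (T.card : ℝ) - E.card ≤ T.card * ε)
    (h2 : ∀ f ∈ E, ∑ f' ∈ T, ∑ x, ν f x * ν f' x / ρ x ≤ T.card * X) :
    ∑ x, |∑ f ∈ E, ν f x - T.card * ρ x| ≤ T.card * (√(X - 1) + √(2 * ε)) := by
  -- Cauchy–Schwarz with weight ρ, whose total mass is 1.
  have hcs := Finset.sum_sq_le_sum_mul_sum_of_sq_le_mul (Finset.univ : Finset Ω)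
    (r := fun x => |∑ f ∈ E, ν f x - T.card * ρ x|)
    (f := fun x => (∑ f ∈ E, ν f x - T.card * ρ x) ^ 2 / ρ x) (g := ρ)
    (fun x _ => div_nonneg (sq_nonneg _) (hρ x).le) (fun x _ => (hρ x).le)
    (fun x _ => by rw [sq_abs, div_mul_cancel₀ _ (hρ x).ne'])
  rw [hρ1, mul_one] at hcs
  have hexp : ∀ x, (∑ f ∈ E, ν f x - T.card * ρ x) ^ 2 / ρ x =
      ∑ f ∈ E, ∑ f' ∈ E, ν f x * ν f' x / ρ x - 2 * T.card * ∑ f ∈ E, ν f x +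
        (T.card : ℝ) ^ 2 * ρ x := by
    intro x
    have h3 : ∑ f ∈ E, ∑ f' ∈ E, ν f x * ν f' x / ρ x = (∑ f ∈ E, ν f x) ^ 2 / ρ x := by
      rw [sq, Finset.sum_mul_sum, Finset.sum_div]
      exact Finset.sum_congr rfl fun f _ => by rw [Finset.sum_div]
    rw [h3]
    have := (hρ x).ne'
    field_simp
    ring
  have hsum : ∑ x, (∑ f ∈ E, ν f x - T.card * ρ x) ^ 2 / ρ x =
      ∑ f ∈ E, ∑ f' ∈ E, ∑ x, ν f x * ν f' x / ρ x - 2 * T.card * E.card +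
        (T.card : ℝ) ^ 2 := by
    simp_rw [hexp]
    rw [Finset.sum_add_distrib, Finset.sum_sub_distrib, ← Finset.mul_sum, ← Finset.mul_sum, hρ1,
      Finset.sum_comm (t := E)]
    rw [Finset.sum_comm (s := Finset.univ) (t := E)]
    simp_rw [hν1]
    have : ∀ f, ∑ x, ∑ f' ∈ E, ν f x * ν f' x / ρ x = ∑ f' ∈ E, ∑ x, ν f x * ν f' x / ρ x :=
      fun f => Finset.sum_comm
    simp_rw [this]
    simp
  have hquad : ∑ f ∈ E, ∑ f' ∈ E, ∑ x, ν f x * ν f' x / ρ x ≤ (T.card : ℝ) ^ 2 * X := by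
    have hnn : ∀ f f', 0 ≤ ∑ x, ν f x * ν f' x / ρ x := fun f f' =>
      Finset.sum_nonneg fun x _ => div_nonneg (mul_nonneg (hν f x) (hν f' x)) (hρ x).le
    -- By nonnegativity the second map may range over all of T; only the first one is truncated.
    calc _ ≤ ∑ f ∈ E, (T.card * X : ℝ) := Finset.sum_le_sum fun f hf =>
          (Finset.sum_le_sum_of_subset_of_nonneg hET fun f' _ _ => hnn f f').trans (h2 f hf)
      _ = E.card * (T.card * X) := by simp
      _ ≤ T.card * (T.card * X) := by
          have : (E.card : ℝ) ≤ T.card := by exact_mod_cast Finset.card_le_card hET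
          gcongr
      _ = _ := by ring
  rw [hsum] at hcs
  have hT : (0 : ℝ) ≤ T.card := by positivity
  -- The expansion is at most |T|²X - 2|T||E| + |T|² = |T|²(X - 1) + 2|T|(|T| - |E|), and the
  -- discarded part is at most ε|T|.
  have hcs2 : (∑ x, |∑ f ∈ E, ν f x - T.card * ρ x|) ^ 2 ≤
      (T.card : ℝ) ^ 2 * (X - 1 + 2 * ε) := by nlinarith
  calc _ ≤ √((T.card : ℝ) ^ 2 * (X - 1 + 2 * ε)) := Real.le_sqrt_of_sq_le hcs2
    _ = T.card * √(X - 1 + 2 * ε) := by rw [Real.sqrt_mul (sq_nonneg _), Real.sqrt_sq hT]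
    _ ≤ _ := by
        gcongr
        have h1 := Real.sq_sqrt (by linarith : 0 ≤ X - 1)
        have h2 := Real.sq_sqrt (by positivity : 0 ≤ 2 * ε)
        rw [Real.sqrt_le_left (by positivity)]
        nlinarith [mul_nonneg (Real.sqrt_nonneg (X - 1)) (Real.sqrt_nonneg (2 * ε))]

/-- Three pieces: the bad indices contribute at most their mass, on the good ones μ is exchanged for
ν, and the truncated mixture of ν is compared with ρ. -/
lemma sum_abs_sum_sub_const_le {ι Ω : Type*} [Fintype Ω] (T : Finset ι) (P : ι → Prop)
    [DecidablePred P] (μ ν : ι → Ω → ℝ) (ρ : Ω → ℝ) (hμ : ∀ f x, 0 ≤ μ f x)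
    (hμ1 : ∀ f, ∑ x, μ f x ≤ 1) {ε δ Y : ℝ}
    (hE : ((T.filter fun f => ¬ P f).card : ℝ) ≤ T.card * ε)
    (hδ : ∀ f, P f → ∑ x, |μ f x - ν f x| ≤ δ) (hδ0 : 0 ≤ δ)
    (hY : ∑ x, |∑ f ∈ T.filter P, ν f x - T.card * ρ x| ≤ T.card * Y) :
    ∑ x, |∑ f ∈ T, (μ f x - ρ x)| ≤ T.card * (ε + δ + Y) := by
  have hsplit : ∀ x, ∑ f ∈ T, (μ f x - ρ x) = ∑ f ∈ T.filter (fun f => ¬ P f), μ f x +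
      ∑ f ∈ T.filter P, (μ f x - ν f x) + (∑ f ∈ T.filter P, ν f x - T.card * ρ x) := by
    intro x
    rw [Finset.sum_sub_distrib, Finset.sum_sub_distrib,
      ← Finset.sum_filter_add_sum_filter_not T P fun f => μ f x]
    simp
    ring
  have h1 : ∑ x, |∑ f ∈ T.filter (fun f => ¬ P f), μ f x| ≤ T.card * ε := by
    calc _ ≤ ∑ x, ∑ f ∈ T.filter (fun f => ¬ P f), μ f x := by
          refine Finset.sum_le_sum fun x _ => le_of_eq (abs_of_nonneg ?_)
          exact Finset.sum_nonneg fun f _ => hμ f x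
      _ = ∑ f ∈ T.filter (fun f => ¬ P f), ∑ x, μ f x := Finset.sum_comm
      _ ≤ ∑ f ∈ T.filter (fun f => ¬ P f), (1 : ℝ) :=
          Finset.sum_le_sum fun f _ => hμ1 f
      _ ≤ _ := by simpa using hE
  have h2 : ∑ x, |∑ f ∈ T.filter P, (μ f x - ν f x)| ≤ T.card * δ := by
    calc _ ≤ ∑ x, ∑ f ∈ T.filter P, |μ f x - ν f x| :=
          Finset.sum_le_sum fun x _ => Finset.abs_sum_le_sum_abs _ _
      _ = ∑ f ∈ T.filter P, ∑ x, |μ f x - ν f x| := Finset.sum_comm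
      _ ≤ ∑ f ∈ T.filter P, δ := Finset.sum_le_sum fun f hf => hδ f (Finset.mem_filter.1 hf).2
      _ = (T.filter P).card * δ := by simp
      _ ≤ _ := by
          have : ((T.filter P).card : ℝ) ≤ T.card := by
            exact_mod_cast Finset.card_filter_le _ _
          gcongr
  calc _ ≤ ∑ x, (|∑ f ∈ T.filter (fun f => ¬ P f), μ f x| +
        |∑ f ∈ T.filter P, (μ f x - ν f x)| + |∑ f ∈ T.filter P, ν f x - T.card * ρ x|) := by
        refine Finset.sum_le_sum fun x _ => ?_
        rw [hsplit]
        exact abs_add_three _ _ _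
    _ ≤ _ := by
        rw [Finset.sum_add_distrib, Finset.sum_add_distrib]
        linarith

end L1

/-! ### Replacing P' by the binomial law -/

section

variable {ℓ : ℕ} {γ p q : I} {n N : ℕ}

lemma avgMass_nonneg (hv : ValidMasses ℓ γ p q) (C : Set (Fin n)) (f : Fin N → Fin n)
    (d : Sym2 (Fin n)) (m : ℕ) : 0 ≤ avgMass ℓ γ p q C f d m := by
  unfold avgMass
  split_ifs with h
  · exact (hv _ _ (by omega) (by omega)).1.1 m
  · exact binomMass_nonneg _ _ _

lemma sum_avgMass (C : Set (Fin n)) (f : Fin N → Fin n) (d : Sym2 (Fin n)) :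
    ∑ m ∈ Finset.range ((blockOf f d).ncard + 1), avgMass ℓ γ p q C f d m = 1 := by
  unfold avgMass
  split_ifs with h
  · rw [ncard_blockOf_of_not_isDiag f h.1, sum_massP]
  · exact sum_binomMass _ _

/-- A graph is determined by its traces on the blocks, so sums over graphs are dominated by sums
over arbitrary families, where the product structure is available. -/
lemma sum_graph_le_sum_families {f : Fin N → Fin n}
    (g : (Sym2 (Fin n) → Set (Sym2 (Fin N))) → ℝ) (hg : ∀ F, 0 ≤ g F)
    [Fintype (Sym2 (Fin n) → Set (Sym2 (Fin N)))] [Fintype (SimpleGraph (Fin N))] :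
    ∑ H : SimpleGraph (Fin N), g (fun d => H.edgeSet ∩ blockOf f d) ≤ ∑ F, g F := by
  classical
  have hinj : Function.Injective fun (H : SimpleGraph (Fin N)) (d : Sym2 (Fin n)) =>
      H.edgeSet ∩ blockOf f d := by
    have hsub : ∀ H H' : SimpleGraph (Fin N), (fun d : Sym2 (Fin n) => H.edgeSet ∩ blockOf f d) =
        (fun d => H'.edgeSet ∩ blockOf f d) → H.edgeSet ⊆ H'.edgeSet := by
      intro H H' h e he
      have h1 := congrFun h (e.map f)
      have h2 : e ∈ H.edgeSet ∩ blockOf f (e.map f) :=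
        ⟨he, H.not_isDiag_of_mem_edgeSet he, rfl⟩
      rw [h1] at h2
      exact h2.1
    intro H H' h
    exact SimpleGraph.edgeSet_injective ((hsub H H' h).antisymm (hsub H' H h.symm))
  rw [← Finset.sum_image (s := Finset.univ) (g := fun (H : SimpleGraph (Fin N))
    (d : Sym2 (Fin n)) => H.edgeSet ∩ blockOf f d) (f := g) hinj.injOn]
  exact Finset.sum_le_univ_sum_of_nonneg hg

lemma outputMass_nonneg (hv : ValidMasses ℓ γ p q) (C : Set (Fin n)) (f : Fin N → Fin n)
    (H : SimpleGraph (Fin N)) : 0 ≤ outputMass ℓ γ p q C f H :=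
  Finset.prod_nonneg fun d _ => blockMass_nonneg (avgMass_nonneg hv C f d) _ _

lemma sum_outputMass_le (hv : ValidMasses ℓ γ p q) (C : Set (Fin n)) (f : Fin N → Fin n)
    [Fintype (SimpleGraph (Fin N))] :
    ∑ H, outputMass ℓ γ p q C f H ≤ 1 := by
  classical
  have h := sum_graph_le_sum_families (f := f)
    (fun F => ∏ d, blockMass (avgMass ℓ γ p q C f d) (blockOf f d) (F d))
    (fun F => Finset.prod_nonneg fun d _ => blockMass_nonneg (avgMass_nonneg hv C f d) _ _)
  refine h.trans (le_of_eq ?_)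
  have h2 := Finset.prod_univ_sum (fun _ : Sym2 (Fin n) =>
    (Finset.univ : Finset (Set (Sym2 (Fin N)))))
    (fun d x => blockMass (avgMass ℓ γ p q C f d) (blockOf f d) x)
  rw [Fintype.piFinset_univ] at h2
  rw [← h2]
  exact Finset.prod_eq_one fun d _ => by rw [sum_blockMass, sum_avgMass]

open Classical in
/-- The edge probability, between vertices with parents in `d`, of the comparison graph in which the
pairs with distinct parents in `C` have probability `p` and all others have probability `q`. -/
noncomputable def blockProb (p q : I) (C : Set (Fin n)) (d : Sym2 (Fin n)) : I :=
  if ¬ d.IsDiag ∧ d ∈ pairsIn C then p else q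

open Classical in
lemma card_filter_pairsIn_le {k : ℕ} {C : Set (Fin n)} (hC : C.ncard = k) :
    (Finset.univ.filter fun d : Sym2 (Fin n) => d ∈ pairsIn C).card ≤ k ^ 2 := by
  have h : (Finset.univ.filter fun d : Sym2 (Fin n) => d ∈ pairsIn C) ⊆
      (C.toFinset ×ˢ C.toFinset).image fun x => s(x.1, x.2) := by
    intro d
    induction d with | _ a b
    intro h
    have h' : s(a, b) ∈ pairsIn C := by simpa using h
    exact Finset.mem_image.2 ⟨(a, b), by simpa using ⟨h' a (by simp), h' b (by simp)⟩, rfl⟩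
  calc _ ≤ _ := Finset.card_le_card h
    _ ≤ _ := Finset.card_image_le
    _ = _ := by rw [Finset.card_product, ← Set.ncard_eq_toFinset_card', hC, sq]

/-- By the hybrid argument the block errors add up. With few children no block inside C is
oversized, so P' faces Binom(ab, p) there at cost 4x^(m₀+1), x = 8qℓ² ≤ 1/2; all other blocks agree.
-/
lemma sum_abs_outputMass_sub_le {k : ℕ} (hv : ValidMasses ℓ γ p q) (h0 : 0 < (γ : ℝ))
    (hp : (p : ℝ) = 2 * q) (hq : 16 * (q : ℝ) * (ℓ : ℝ) ^ 2 ≤ 1) {C : Set (Fin n)}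
    (hC : C.ncard = k) {f : Fin N → Fin n} (hf : FewChildren ℓ C f)
    [Fintype (SimpleGraph (Fin N))] :
    ∑ H, |outputMass ℓ γ p q C f H - edgeLaw (fun e => (blockProb p q C (e.map f) : ℝ)) H| ≤
      4 * (k : ℝ) ^ 2 * (8 * (q : ℝ) * (ℓ : ℝ) ^ 2) ^ (mZero γ + 1) := by
  classical
  have hq0 : (0 : ℝ) ≤ q := q.2.1
  simp_rw [← prod_blockMass_binomMass f (blockProb p q C), outputMass]
  have h := sum_graph_le_sum_families (f := f)
    (fun F => |∏ d, blockMass (avgMass ℓ γ p q C f d) (blockOf f d) (F d) -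
      ∏ d, blockMass (binomMass (blockOf f d).ncard (blockProb p q C d)) (blockOf f d) (F d)|)
    (fun F => abs_nonneg _)
  refine h.trans ((sum_abs_prod_sub_prod_le
    (fun d x => blockMass (avgMass ℓ γ p q C f d) (blockOf f d) x)
    (fun d x => blockMass (binomMass (blockOf f d).ncard (blockProb p q C d)) (blockOf f d) x)
    (fun d x => blockMass_nonneg (avgMass_nonneg hv C f d) _ _)
    (fun d x => blockMass_nonneg (binomMass_nonneg _ _) _ _)
    (fun d => by rw [sum_blockMass, sum_avgMass])
    (fun d => by rw [sum_blockMass, sum_binomMass])).trans ?_)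
  have hd : ∀ d : Sym2 (Fin n), ∑ x, |blockMass (avgMass ℓ γ p q C f d) (blockOf f d) x -
      blockMass (binomMass (blockOf f d).ncard (blockProb p q C d)) (blockOf f d) x| ≤
      if d ∈ pairsIn C then 4 * (8 * (q : ℝ) * (ℓ : ℝ) ^ 2) ^ (mZero γ + 1) else 0 := by
    intro d
    rw [sum_abs_blockMass_sub]
    by_cases h1 : ¬ d.IsDiag ∧ d ∈ pairsIn C
    · have hinf : numChildren f d.inf ≤ 2 * ℓ := hf _ (h1.2 _ (by
        induction d with | _ a b
        rcases le_total a b with h | h <;> simp [h]))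
      have hsup : numChildren f d.sup ≤ 2 * ℓ := hf _ (h1.2 _ (by
        induction d with | _ a b
        rcases le_total a b with h | h <;> simp [h]))
      rw [if_pos h1.2]
      have h2 : ∀ m, avgMass ℓ γ p q C f d m =
          massP γ p q (numChildren f d.inf) (numChildren f d.sup) m := fun m => by
        rw [avgMass, if_pos ⟨h1.1, h1.2, max_le hinf hsup⟩]
      have h3 : blockProb p q C d = p := if_pos h1
      simp_rw [h2, h3, ncard_blockOf_of_not_isDiag f h1.1]
      exact sum_abs_massP_sub_le h0 hp (two_mul_mul_le hq0 hinf hsup) (by linarith)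
    · have h2 : ∀ m, avgMass ℓ γ p q C f d m = binomMass (blockOf f d).ncard q m := fun m => by
        rw [avgMass, if_neg fun h => h1 ⟨h.1, h.2.1⟩]
      have h3 : blockProb p q C d = q := if_neg h1
      simp_rw [h2, h3]
      simp only [sub_self, abs_zero, Finset.sum_const_zero]
      split_ifs <;> positivity
  refine (Finset.sum_le_sum fun d _ => hd d).trans ?_
  rw [← Finset.sum_filter, Finset.sum_const, nsmul_eq_mul]
  have hc : ((Finset.univ.filter fun d : Sym2 (Fin n) => d ∈ pairsIn C).card : ℝ) ≤
      (k : ℝ) ^ 2 := by exact_mod_cast card_filter_pairsIn_le hC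
  calc _ ≤ (k : ℝ) ^ 2 * (4 * (8 * (q : ℝ) * (ℓ : ℝ) ^ 2) ^ (mZero γ + 1)) := by gcongr
    _ = _ := by ring

/-! ### Second moment of the comparison law -/

open Classical in
/-- The edge probabilities of the planted dense subgraph model with planted set `S`. -/
noncomputable def denseProb (p q : I) (S : Set (Fin N)) (e : Sym2 (Fin N)) : ℝ :=
  if e ∈ pairsIn S then (p : ℝ) else q

lemma map_mem_pairsIn_iff {C : Set (Fin n)} {S : Set (Fin N)} {f : Fin N → Fin n}
    (hf : f ∈ parentMaps C S) (e : Sym2 (Fin N)) : e.map f ∈ pairsIn C ↔ e ∈ pairsIn S := by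
  rw [← mem_parentMaps.1 hf]
  induction e with | _ i j
  simp [pairsIn]

/-- The contribution of a colliding pair: both comparison laws have probability x there, the planted
law 2x. -/
lemma chi_factor {x : ℝ} (h0 : 0 < x) (h1 : x ≤ 1 / 16) :
    x * x / (2 * x) + (1 - x) * (1 - x) / (1 - 2 * x) = 1 + x / (2 * (1 - 2 * x)) := by
  have hi : (1 - 2 * x) * (1 - 2 * x)⁻¹ = 1 := mul_inv_cancel₀ (by linarith)
  have hx : x * x / (2 * x) = x / 2 := by field_simp
  rw [hx, div_eq_mul_inv _ (1 - 2 * x), div_eq_mul_inv x (2 * (1 - 2 * x)), mul_inv]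
  linear_combination (1 - x / 2) * hi

/-- At a pair in S that is not a sibling pair under one of the maps, that map's probability equals
the planted one and the factor is 1; outside S all probabilities are q. Only common sibling pairs
remain. -/
lemma sum_edgeLaw_mul_div_eq {C : Set (Fin n)} {S : Set (Fin N)} {f f' : Fin N → Fin n}
    (hf : f ∈ parentMaps C S) (hf' : f' ∈ parentMaps C S) (hp : (p : ℝ) = 2 * q)
    (hq0 : 0 < (q : ℝ)) (hq1 : (q : ℝ) ≤ 1 / 16) [Fintype S] [Fintype (SimpleGraph (Fin N))] :
    ∑ H, edgeLaw (fun e => (blockProb p q C (e.map f) : ℝ)) H *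
      edgeLaw (fun e => (blockProb p q C (e.map f') : ℝ)) H / edgeLaw (denseProb p q S) H =
      (1 + q / (2 * (1 - 2 * q)) : ℝ) ^ (collisions f f' S.toFinset).card := by
  classical
  have hq' := hq0.ne'
  have hp0 : 2 * (q : ℝ) ≠ 0 := by linarith
  have hp1 : 1 - 2 * (q : ℝ) ≠ 0 := by linarith
  have hq2 : 1 - (q : ℝ) ≠ 0 := by linarith
  rw [sum_edgeLaw_mul_div, collisions, ← Finset.prod_const, Finset.prod_filter]
  refine Finset.prod_congr rfl fun e _ => ?_
  by_cases hS : e ∈ pairsIn S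
  · have hC := (map_mem_pairsIn_iff hf e).2 hS
    have hC' := (map_mem_pairsIn_iff hf' e).2 hS
    by_cases h1 : (e.map f).IsDiag
    · by_cases h2 : (e.map f').IsDiag
      · simp only [blockProb, denseProb, hS, hC, hC', h1, h2, hp, not_true, false_and, if_true,
          if_false, Set.coe_toFinset, and_self]
        exact chi_factor hq0 hq1
      · simp only [blockProb, denseProb, hS, hC, hC', h1, h2, hp, not_true, false_and, if_true,
          if_false, Set.coe_toFinset, and_false, not_false_iff, and_self]
        rw [mul_div_cancel_right₀ _ hp0, mul_div_cancel_right₀ _ hp1]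
        ring
    · simp only [blockProb, denseProb, hS, hC, h1, hp, if_true,
          if_false, Set.coe_toFinset, and_false, false_and, not_false_iff, and_self]
      field_simp
      ring
  · have hC := mt (map_mem_pairsIn_iff hf e).1 hS
    have hC' := mt (map_mem_pairsIn_iff hf' e).1 hS
    simp only [blockProb, denseProb, hS, hC, hC', if_false, Set.coe_toFinset, and_false, false_and]
    field_simp
    ring

/-- As y ≤ q, the collision bound is at most (1 + 4qℓ/k)^|S| ≤ exp(4qℓ/k · 1.5kℓ), whose exponent is
6qℓ². -/
lemma sum_sum_edgeLaw_mul_div_le {k : ℕ} {C : Set (Fin n)} (hC : C.ncard = k) (hk : 1 ≤ k)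
    (hℓ : 1 ≤ ℓ) {S : Set (Fin N)} (hS : (S.ncard : ℝ) ≤ 1.5 * (k * ℓ)) {f : Fin N → Fin n}
    (hf : f ∈ parentMaps C S) (hE : FewChildren ℓ C f) (hp : (p : ℝ) = 2 * q)
    (hq0 : 0 < (q : ℝ)) (hq : 16 * (q : ℝ) * (ℓ : ℝ) ^ 2 ≤ 1) [Fintype (SimpleGraph (Fin N))] :
    ∑ f' ∈ parentMaps C S, ∑ H, edgeLaw (fun e => (blockProb p q C (e.map f) : ℝ)) H *
      edgeLaw (fun e => (blockProb p q C (e.map f') : ℝ)) H / edgeLaw (denseProb p q S) H ≤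
      (parentMaps C S).card * Real.exp (6 * q * (ℓ : ℝ) ^ 2) := by
  classical
  have hℓ' : (1 : ℝ) ≤ ℓ := by exact_mod_cast hℓ
  have hk' : (0 : ℝ) < k := by exact_mod_cast hk
  have hqℓ : (q : ℝ) * ℓ ≤ q * (ℓ : ℝ) ^ 2 := by
    gcongr
    nlinarith
  have hq1 : (q : ℝ) ≤ 1 / 16 := by nlinarith
  have hy0 : 0 ≤ (q : ℝ) / (2 * (1 - 2 * q)) := div_nonneg hq0.le (by linarith)
  have hyq : (q : ℝ) / (2 * (1 - 2 * q)) ≤ q := by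
    rw [div_le_iff₀ (by linarith)]
    nlinarith
  rw [Finset.sum_congr rfl fun f' hf' => sum_edgeLaw_mul_div_eq hf hf' hp hq0 hq1]
  refine (sum_pow_card_collisions_le hC hk hf hE hy0 ?_ S.toFinset (by simp)).trans ?_
  · push_cast
    calc (q : ℝ) / (2 * (1 - 2 * q)) * (2 * ℓ) ≤ q * (2 * ℓ) := by gcongr
      _ ≤ 1 := by linarith
  · gcongr
    rw [← Set.ncard_eq_toFinset_card']
    calc (1 + 4 * ((q : ℝ) / (2 * (1 - 2 * q))) * ℓ / k) ^ S.ncard ≤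
          Real.exp (4 * q * ℓ / k) ^ S.ncard := by
          gcongr
          refine le_trans ?_ (Real.add_one_le_exp _)
          rw [add_comm]
          gcongr
      _ = Real.exp (S.ncard * (4 * q * ℓ / k)) := by rw [Real.exp_nat_mul]
      _ ≤ _ := by
          apply Real.exp_le_exp.2
          calc (S.ncard : ℝ) * (4 * q * ℓ / k) ≤ 1.5 * (k * ℓ) * (4 * q * ℓ / k) := by gcongr
            _ = _ := by field_simp; norm_num

lemma denseProb_nonneg (S : Set (Fin N)) (e : Sym2 (Fin N)) : 0 ≤ denseProb p q S e := by
  unfold denseProb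
  split_ifs
  exacts [p.2.1, q.2.1]

lemma denseProb_le_one (S : Set (Fin N)) (e : Sym2 (Fin N)) : denseProb p q S e ≤ 1 := by
  unfold denseProb
  split_ifs
  exacts [p.2.2, q.2.2]

open Classical in
/-- The comparison law, averaged over the parent maps with `f ⁻¹' C = S` and few children, is close
to the planted dense subgraph law with planted set `S`. -/
lemma sum_abs_sum_edgeLaw_sub_le {k : ℕ} {C : Set (Fin n)} (hC : C.ncard = k) (hk : 1 ≤ k)
    (hℓ : 1 ≤ ℓ) {S : Set (Fin N)} (hS : (S.ncard : ℝ) ≤ 1.5 * (k * ℓ)) (hp : (p : ℝ) = 2 * q)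
    (hq : 16 * (q : ℝ) * (ℓ : ℝ) ^ 2 ≤ 1) [Fintype (SimpleGraph (Fin N))] {X : ℝ}
    (hX : Real.exp (6 * q * (ℓ : ℝ) ^ 2) ≤ X) :
    ∑ H, |∑ f ∈ (parentMaps C S).filter (FewChildren ℓ C),
        edgeLaw (fun e => (blockProb p q C (e.map f) : ℝ)) H -
        (parentMaps C S).card * edgeLaw (denseProb p q S) H| ≤
      (parentMaps C S).card * (k * Real.exp (-(ℓ : ℝ) / 18) +
        (√(X - 1) + √(2 * (k * Real.exp (-(ℓ : ℝ) / 18))))) := by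
  have hε : (0 : ℝ) ≤ k * Real.exp (-(ℓ : ℝ) / 18) := by positivity
  have hbad := card_filter_not_fewChildren_le (ℓ := ℓ) hC hk hS
  have hcard := Finset.card_filter_add_card_filter_not (s := parentMaps C S) (FewChildren ℓ C)
  have hcard' : ((parentMaps C S).card : ℝ) - ((parentMaps C S).filter (FewChildren ℓ C)).card =
      ((parentMaps C S).filter fun f => ¬ FewChildren ℓ C f).card := by
    rw [← hcard]
    push_cast
    ring
  have hℓ' : (1 : ℝ) ≤ ℓ := by exact_mod_cast hℓ
  -- For q = 0 the reference law has zeros and cannot be divided by; but then p = q, the laws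
  -- coincide, and only the discarded fraction remains. This case accounts for the extra term
  -- k·exp(-ℓ/18) in the bound.
  rcases (q.2.1 : (0 : ℝ) ≤ q).eq_or_lt with h0 | h0
  · have hpq : p = q := by
      apply Subtype.ext
      linarith
    have hlaw : ∀ f : Fin N → Fin n, (fun e : Sym2 (Fin N) => (blockProb p q C (e.map f) : ℝ)) =
        denseProb p q S := by
      intro f
      funext e
      rw [blockProb, denseProb, hpq, ite_self, ite_self]
    simp only [hlaw, Finset.sum_const, nsmul_eq_mul, ← sub_mul]
    have : ∀ H, |(((parentMaps C S).filter (FewChildren ℓ C)).card - (parentMaps C S).card : ℝ) *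
        edgeLaw (denseProb p q S) H| =
        ((parentMaps C S).filter fun f => ¬ FewChildren ℓ C f).card *
          edgeLaw (denseProb p q S) H := by
      intro H
      rw [abs_mul, abs_sub_comm, hcard', abs_of_nonneg (Nat.cast_nonneg _),
        abs_of_nonneg (edgeLaw_nonneg (denseProb_nonneg S) (denseProb_le_one S) H)]
    simp only [this]
    rw [← Finset.mul_sum, sum_edgeLaw, mul_one]
    refine hbad.trans (mul_le_mul_of_nonneg_left ?_ (Nat.cast_nonneg _))
    exact le_add_of_nonneg_right (add_nonneg (Real.sqrt_nonneg _) (Real.sqrt_nonneg _))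
  · have hq1 : (q : ℝ) ≤ 1 / 16 := by nlinarith [one_le_pow₀ hℓ' (n := 2)]
    have hX1 : 1 ≤ X := (Real.one_le_exp (by positivity)).trans hX
    refine (sum_abs_mixture_sub_le (parentMaps C S) ((parentMaps C S).filter (FewChildren ℓ C))
      (Finset.filter_subset _ _) (fun f => edgeLaw fun e => (blockProb p q C (e.map f) : ℝ))
      (edgeLaw (denseProb p q S))
      (fun f => edgeLaw_nonneg (fun e => (blockProb p q C (e.map f)).2.1)
        fun e => (blockProb p q C (e.map f)).2.2)
      (fun f => sum_edgeLaw _) (edgeLaw_pos ?_ ?_) (sum_edgeLaw _) hε hX1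
      (hcard'.le.trans hbad) ?_).trans ?_
    · intro e
      unfold denseProb
      split_ifs <;> linarith
    · intro e
      unfold denseProb
      split_ifs <;> linarith
    · intro f hf
      rw [Finset.mem_filter] at hf
      refine (sum_sum_edgeLaw_mul_div_le hC hk hℓ hS hf.1 hf.2 hp h0 hq).trans ?_
      gcongr
    · exact mul_le_mul_of_nonneg_left (by linarith) (by positivity)

lemma sum_abs_sum_outputMass_sub_le {k : ℕ} (hv : ValidMasses ℓ γ p q) (h0 : 0 < (γ : ℝ))
    {C : Set (Fin n)} (hC : C.ncard = k) (hk : 1 ≤ k)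
    (hℓ : 1 ≤ ℓ) {S : Set (Fin N)} (hS : (S.ncard : ℝ) ≤ 1.5 * (k * ℓ)) (hp : (p : ℝ) = 2 * q)
    (hq : 16 * (q : ℝ) * (ℓ : ℝ) ^ 2 ≤ 1) [Fintype (SimpleGraph (Fin N))] {X : ℝ}
    (hX : Real.exp (6 * q * (ℓ : ℝ) ^ 2) ≤ X) :
    ∑ H, |∑ f ∈ parentMaps C S, (outputMass ℓ γ p q C f H - edgeLaw (denseProb p q S) H)| ≤
      (parentMaps C S).card * (2 * (k * Real.exp (-(ℓ : ℝ) / 18)) +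
        4 * (k : ℝ) ^ 2 * (8 * (q : ℝ) * (ℓ : ℝ) ^ 2) ^ (mZero γ + 1) +
        (√(X - 1) + √(2 * (k * Real.exp (-(ℓ : ℝ) / 18))))) := by
  classical
  have hq0 : (0 : ℝ) ≤ q := q.2.1
  refine (sum_abs_sum_sub_const_le (parentMaps C S) (FewChildren ℓ C) (outputMass ℓ γ p q C)
    (fun f => edgeLaw fun e => (blockProb p q C (e.map f) : ℝ)) (edgeLaw (denseProb p q S))
    (outputMass_nonneg hv C) (fun f => sum_outputMass_le hv C f)
    (card_filter_not_fewChildren_le hC hk hS)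
    (fun f hf => sum_abs_outputMass_sub_le hv h0 hp hq hC hf) (by positivity)
    (sum_abs_sum_edgeLaw_sub_le hC hk hℓ hS hp hq hX)).trans (le_of_eq ?_)
  ring

lemma sum_abs_sum_outputMass_sub_le_two_mul (hv : ValidMasses ℓ γ p q) (C : Set (Fin n))
    (S : Set (Fin N)) [Fintype (SimpleGraph (Fin N))] :
    ∑ H, |∑ f ∈ parentMaps C S, (outputMass ℓ γ p q C f H - edgeLaw (denseProb p q S) H)| ≤
      2 * (parentMaps C S).card := by
  calc _ ≤ ∑ H, ∑ f ∈ parentMaps C S,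
        (outputMass ℓ γ p q C f H + edgeLaw (denseProb p q S) H) := by
        refine Finset.sum_le_sum fun H _ => (Finset.abs_sum_le_sum_abs _ _).trans ?_
        refine Finset.sum_le_sum fun f _ => ?_
        have h1 := outputMass_nonneg hv C f H
        have h2 := edgeLaw_nonneg (denseProb_nonneg (p := p) (q := q) S) (denseProb_le_one S) H
        rw [abs_le]
        constructor <;> linarith
    _ = ∑ f ∈ parentMaps C S, (∑ H, outputMass ℓ γ p q C f H +
        ∑ H, edgeLaw (denseProb p q S) H) := by
        rw [Finset.sum_comm]
        exact Finset.sum_congr rfl fun f _ => Finset.sum_add_distrib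
    _ ≤ ∑ f ∈ parentMaps C S, (2 : ℝ) := by
        refine Finset.sum_le_sum fun f _ => ?_
        rw [sum_edgeLaw]
        linarith [sum_outputMass_le hv C f]
    _ = _ := by simp [mul_comm]

lemma sum_parentMaps {C : Set (Fin n)} (φ : (Fin N → Fin n) → ℝ) [Fintype (Set (Fin N))] :
    ∑ f, φ f = ∑ S : Set (Fin N), ∑ f ∈ parentMaps C S, φ f := by
  classical
  rw [← Finset.sum_fiberwise Finset.univ (fun f : Fin N → Fin n => f ⁻¹' C)]
  refine Finset.sum_congr rfl fun S _ => Finset.sum_congr ?_ fun _ _ => rfl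
  ext f
  simp [mem_parentMaps]

/-- The distance to the planted dense subgraph model for a fixed clique `C`. -/
lemma sum_abs_outputMass_mixture_sub_le {k K : ℕ} (hv : ValidMasses ℓ γ p q) (h0 : 0 < (γ : ℝ))
    {C : Set (Fin n)} (hC : C.ncard = k) (hk : 1 ≤ k) (hn : n ≠ 0) (hN : N = ℓ * n)
    (hK : K = k * ℓ) (hℓ : 1 ≤ ℓ) (hp : (p : ℝ) = 2 * q)
    (hq : 16 * (q : ℝ) * (ℓ : ℝ) ^ 2 ≤ 1) [Fintype (SimpleGraph (Fin N))] {X : ℝ}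
    (hX : Real.exp (6 * q * (ℓ : ℝ) ^ 2) ≤ X) :
    ∑ H, |∑ f, (1 / (n : ℝ)) ^ N * outputMass ℓ γ p q C f H - (plantedDense N K p q).real {H}| ≤
      2 * Real.exp (-((k : ℝ) * ℓ) / 12) + (2 * (k * Real.exp (-(ℓ : ℝ) / 18)) +
        4 * (k : ℝ) ^ 2 * (8 * (q : ℝ) * (ℓ : ℝ) ^ 2) ^ (mZero γ + 1) +
        (√(X - 1) + √(2 * (k * Real.exp (-(ℓ : ℝ) / 18))))) := by
  classical
  set R : ℝ := 2 * (k * Real.exp (-(ℓ : ℝ) / 18)) +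
        4 * (k : ℝ) ^ 2 * (8 * (q : ℝ) * (ℓ : ℝ) ^ 2) ^ (mZero γ + 1) +
        (√(X - 1) + √(2 * (k * Real.exp (-(ℓ : ℝ) / 18)))) with hR
  have hq0 : (0 : ℝ) ≤ q := q.2.1
  have hR0 : 0 ≤ R := by positivity
  -- Both models are split according to the planted set, which carries the same weight in each.
  have hdiff : ∀ H, ∑ f, (1 / (n : ℝ)) ^ N * outputMass ℓ γ p q C f H -
      (plantedDense N K p q).real {H} = ∑ S : Set (Fin N), (1 / (n : ℝ)) ^ N *
        ∑ f ∈ parentMaps C S, (outputMass ℓ γ p q C f H - edgeLaw (denseProb p q S) H) := by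
    intro H
    rw [plantedDense_real_singleton, sum_parentMaps (C := C), ← Finset.sum_sub_distrib]
    refine Finset.sum_congr rfl fun S _ => ?_
    rw [setBernoulli_real_eq_card_parentMaps hC hℓ hn hN hK, Finset.sum_sub_distrib,
      ← Finset.mul_sum, Finset.sum_const, nsmul_eq_mul, mul_sub, mul_assoc]
    rfl
  have hS : ∀ S : Set (Fin N), ∑ H, |∑ f ∈ parentMaps C S,
      (outputMass ℓ γ p q C f H - edgeLaw (denseProb p q S) H)| ≤
      ∑ f ∈ parentMaps C S, ((if 1.5 * ((k : ℝ) * ℓ) < (f ⁻¹' C).ncard then 2 else 0) + R) := by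
    intro S
    have hconst : ∑ f ∈ parentMaps C S,
        ((if 1.5 * ((k : ℝ) * ℓ) < (f ⁻¹' C).ncard then 2 else 0) + R) =
        (parentMaps C S).card * ((if 1.5 * ((k : ℝ) * ℓ) < S.ncard then 2 else 0) + R) := by
      refine (Finset.sum_congr rfl fun f hf => ?_).trans
        ((Finset.sum_const ((if 1.5 * ((k : ℝ) * ℓ) < S.ncard then 2 else 0) + R)).trans
          (nsmul_eq_mul _ _))
      rw [mem_parentMaps.1 hf]
    rw [hconst]
    -- Atypically large S receive the trivial bound 2, to be paid for by the Chernoff bound on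
    -- |f⁻¹(C)|.
    split_ifs with h
    · refine (sum_abs_sum_outputMass_sub_le_two_mul hv C S).trans ?_
      rw [mul_comm]
      gcongr
      linarith
    · rw [zero_add]
      exact sum_abs_sum_outputMass_sub_le hv h0 hC hk hℓ (not_lt.1 h) hp hq hX
  calc _ ≤ ∑ H, ∑ S : Set (Fin N), (1 / (n : ℝ)) ^ N *
        |∑ f ∈ parentMaps C S, (outputMass ℓ γ p q C f H - edgeLaw (denseProb p q S) H)| := by
        refine Finset.sum_le_sum fun H _ => ?_
        rw [hdiff]
        refine (Finset.abs_sum_le_sum_abs _ _).trans (Finset.sum_le_sum fun S _ => ?_)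
        rw [abs_mul, abs_of_nonneg (by positivity : (0 : ℝ) ≤ (1 / (n : ℝ)) ^ N)]
    _ = ∑ S : Set (Fin N), (1 / (n : ℝ)) ^ N * ∑ H,
        |∑ f ∈ parentMaps C S, (outputMass ℓ γ p q C f H - edgeLaw (denseProb p q S) H)| := by
        rw [Finset.sum_comm]
        simp_rw [Finset.mul_sum]
    _ ≤ ∑ S : Set (Fin N), (1 / (n : ℝ)) ^ N * ∑ f ∈ parentMaps C S,
        ((if 1.5 * ((k : ℝ) * ℓ) < (f ⁻¹' C).ncard then 2 else 0) + R) := by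
        refine Finset.sum_le_sum fun S _ => ?_
        have := hS S
        gcongr
    _ = (1 / (n : ℝ)) ^ N * ∑ f : Fin N → Fin n,
        ((if 1.5 * ((k : ℝ) * ℓ) < (f ⁻¹' C).ncard then 2 else 0) + R) := by
        rw [← Finset.mul_sum, ← sum_parentMaps]
    _ = 2 * ((1 / (n : ℝ)) ^ N * ((Finset.univ.filter fun f : Fin N → Fin n =>
          1.5 * ((k : ℝ) * ℓ) < (f ⁻¹' C).ncard).card : ℝ)) +
        (∑ _f : Fin N → Fin n, (1 / (n : ℝ)) ^ N) * R := by
        rw [Finset.sum_add_distrib, ← Finset.sum_filter, Finset.sum_const, Finset.sum_const,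
          Finset.sum_const, nsmul_eq_mul, nsmul_eq_mul, nsmul_eq_mul]
        ring
    _ ≤ _ := by
        rw [sum_const_parents hn, one_mul]
        have := card_filter_ncard_preimage_le (N := N) (ℓ := ℓ) hC hn hN
        gcongr

lemma sum_uniformOn_ncard {k : ℕ} (hkn : k ≤ n) [Fintype (Set (Fin n))] :
    ∑ C : Set (Fin n), (uniformOn {C : Set (Fin n) | C.ncard = k}).real {C} = 1 := by
  have hne : {C : Set (Fin n) | C.ncard = k}.Nonempty := by
    obtain ⟨C, -, hC⟩ := Set.exists_subset_card_eq (s := (Set.univ : Set (Fin n))) (n := k)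
      (by simpa using hkn)
    exact ⟨C, hC⟩
  have := isProbabilityMeasure_uniformOn (Set.toFinite _) hne
  rw [sum_measureReal_singleton]
  simp

end

end PlantedReduction

/-! ### Assembling the three claims -/

open PlantedReduction in
theorem proposition3 (ℓ n k N K : ℕ) (γ q p : unitInterval)
    (hℓ : 1 ≤ ℓ) (hk : 1 ≤ k) (hkn : k ≤ n)
    (hγ₀ : 0 < (γ : ℝ)) (hγ : (γ : ℝ) ≤ 1 / 2)
    (hN : N = ℓ * n) (hK : K = k * ℓ) (hp : (p : ℝ) = 2 * (q : ℝ))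
    (hq : 16 * (q : ℝ) * (ℓ : ℝ) ^ 2 ≤ 1)
    (hkℓ : 6 * Real.exp 1 * (ℓ : ℝ) ≤ (k : ℝ)) :
    (∀ a b : ℕ, a ≤ 2 * ℓ → b ≤ 2 * ℓ →
      PlantedReduction.IsMassFunction (PlantedReduction.massP γ p q a b) ∧
      PlantedReduction.IsMassFunction (PlantedReduction.massQ γ p q a b)) ∧
    (SimpleGraph.binomialRandom (Fin n) γ).bind (PlantedReduction.reduction ℓ γ p q N) =
      SimpleGraph.binomialRandom (Fin N) q ∧
    PlantedReduction.tvDist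
        ((PlantedReduction.plantedClique n k γ).bind (PlantedReduction.reduction ℓ γ p q N))
        (PlantedReduction.plantedDense N K p q) ≤
      Real.exp (-(K : ℝ) / 12) + 1.5 * (k : ℝ) * Real.exp (-(ℓ : ℝ) / 18) +
        2 * (k : ℝ) ^ 2 * (8 * (q : ℝ) * (ℓ : ℝ) ^ 2) ^ (PlantedReduction.mZero γ + 1) +
        0.5 * Real.sqrt (Real.exp (72 * Real.exp 1 ^ 2 * (q : ℝ) * (ℓ : ℝ) ^ 2) - 1) +
        Real.sqrt (0.5 * (k : ℝ)) * Real.exp (-(ℓ : ℝ) / 36) := by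
  classical
  have hn : n ≠ 0 := by omega
  have hq0 : (0 : ℝ) ≤ q := q.2.1
  have hv : ValidMasses ℓ γ p q := fun a b ha hb => by
    have hx : 2 * ((a * b : ℕ) : ℝ) * (q : ℝ) ≤ 1 / 2 := by
      linarith [two_mul_mul_le hq0 ha hb]
    exact ⟨isMassFunction_massP hγ₀ hγ hp hx, isMassFunction_massQ hγ₀ hγ hp hx⟩
  refine ⟨hv, binomialRandom_bind_reduction hv hγ hn, ?_⟩
  set X : ℝ := Real.exp (72 * Real.exp 1 ^ 2 * (q : ℝ) * (ℓ : ℝ) ^ 2) with hXdef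
  have hX : Real.exp (6 * q * (ℓ : ℝ) ^ 2) ≤ X := by
    apply Real.exp_le_exp.2
    have h1 : (1 : ℝ) ≤ Real.exp 1 ^ 2 := one_le_pow₀ (Real.one_le_exp zero_le_one)
    gcongr
    linarith
  set B : ℝ := 2 * Real.exp (-((k : ℝ) * ℓ) / 12) + (2 * (k * Real.exp (-(ℓ : ℝ) / 18)) +
        4 * (k : ℝ) ^ 2 * (8 * (q : ℝ) * (ℓ : ℝ) ^ 2) ^ (mZero γ + 1) +
        (√(X - 1) + √(2 * (k * Real.exp (-(ℓ : ℝ) / 18))))) with hB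
  -- The target law does not depend on C, so by convexity the bound for a fixed C passes to the
  -- average over C.
  have hmix : ∑ H, |((plantedClique n k γ).bind (reduction ℓ γ p q N)).real {H} -
      (plantedDense N K p q).real {H}| ≤ B := by
    set u : Set (Fin n) → ℝ := fun C => (uniformOn {C : Set (Fin n) | C.ncard = k}).real {C}
    have hu1 : ∑ C, u C = 1 := sum_uniformOn_ncard hkn
    have hu0 : ∀ C, 0 ≤ u C := fun C => measureReal_nonneg
    calc _ ≤ ∑ H, ∑ C, u C * |∑ f, (1 / (n : ℝ)) ^ N * outputMass ℓ γ p q C f H -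
          (plantedDense N K p q).real {H}| := by
          refine Finset.sum_le_sum fun H _ => ?_
          have h1 : ((plantedClique n k γ).bind (reduction ℓ γ p q N)).real {H} -
              (plantedDense N K p q).real {H} =
              ∑ C, u C * (∑ f, (1 / (n : ℝ)) ^ N * outputMass ℓ γ p q C f H -
                (plantedDense N K p q).real {H}) := by
            rw [plantedClique_bind_reduction_real_singleton hv hγ]
            simp_rw [mul_sub]
            rw [Finset.sum_sub_distrib, ← Finset.sum_mul, hu1, one_mul]
          rw [h1]
          refine (Finset.abs_sum_le_sum_abs _ _).trans (Finset.sum_le_sum fun C _ => ?_)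
          rw [abs_mul, abs_of_nonneg (hu0 C)]
      _ = ∑ C, u C * ∑ H, |∑ f, (1 / (n : ℝ)) ^ N * outputMass ℓ γ p q C f H -
          (plantedDense N K p q).real {H}| := by
          rw [Finset.sum_comm]
          simp_rw [Finset.mul_sum]
      _ ≤ ∑ C, u C * B := by
          refine Finset.sum_le_sum fun C _ => ?_
          by_cases hC : C.ncard = k
          · have := sum_abs_outputMass_mixture_sub_le hv hγ₀ hC hk hn hN hK hℓ hp hq hX
            have := hu0 C
            gcongr
          · have : u C = 0 := by
              simp only [u]
              rw [uniformOn_real_singleton, if_neg (by simpa using hC)]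
            rw [this, zero_mul, zero_mul]
      _ = B := by rw [← Finset.sum_mul, hu1, one_mul]
  -- Halved, the truncation term √(2ε) with ε = k·exp(-ℓ/18) is exactly the last term of the claim.
  have hsqrt : √(2 * (k * Real.exp (-(ℓ : ℝ) / 18))) =
      2 * (√(0.5 * (k : ℝ)) * Real.exp (-(ℓ : ℝ) / 36)) := by
    rw [Real.sqrt_eq_iff_mul_self_eq (by positivity) (by positivity), eq_comm]
    have h1 : Real.exp (-(ℓ : ℝ) / 36) * Real.exp (-(ℓ : ℝ) / 36) = Real.exp (-(ℓ : ℝ) / 18) := by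
      rw [← Real.exp_add]
      ring_nf
    have h2 := Real.mul_self_sqrt (by positivity : (0 : ℝ) ≤ 0.5 * (k : ℝ))
    calc _ = 4 * (√(0.5 * (k : ℝ)) * √(0.5 * (k : ℝ))) *
          (Real.exp (-(ℓ : ℝ) / 36) * Real.exp (-(ℓ : ℝ) / 36)) := by ring
      _ = _ := by rw [h1, h2]; ring
  have hKr : (K : ℝ) = k * ℓ := by exact_mod_cast hK
  have hε : (0 : ℝ) ≤ k * Real.exp (-(ℓ : ℝ) / 18) := by positivity
  have htv : tvDist ((plantedClique n k γ).bind (reduction ℓ γ p q N)) (plantedDense N K p q) ≤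
      1 / 2 * B := by
    unfold tvDist
    refine mul_le_mul_of_nonneg_left (le_trans (le_of_eq ?_) hmix) (by norm_num)
    refine Finset.sum_congr ?_ fun _ _ => rfl
    ext; simp
  refine htv.trans ?_
  rw [hB, hsqrt, hKr]
  -- Half of B contains k·exp(-ℓ/18) with coefficient 1, below the claimed 1.5; the other terms
  -- match.
  linarith
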